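/- **Logic.** $\mathrm{FO}^2_{\mathrm{MOD}}[\downarrow,\downarrow^+]$ consists of the first-order formulas with the two variables $x,y$ over unary predicates, equality, the child relation $\downarrow$ and its transitive closure $\downarrow^+$ (descendant), extended by quantifiers $\exists^{\bowtie k,l}y$ with ${\bowtie}\in\{\le,=,\ge\}$, $l\ge 1$, $0\le k<l$; $\exists^{\bowtie k,l}y\,\psi$ means that $(\#\{b:\psi(b)\} \bmod l)\bowtie k$. Models are finite rooted unranked trees whose nodes carry arbitrary sets of unary predicates. The size of a formula is its length, with $k,l$ in binary. **Games.** A tiling game $G=\langle C,T_0,T_1,n,\langle t_0,\dots,t_n\rangle,\Box,L\rangle$ has a finite set $C$ of colours, sets of tiles $T_0,T_1\subseteq C^4$, tiles $t_i\in C^4$, a colour $\Box\in C$ (white) and $L\subseteq T_0\cup T_1$. Its size is $|C|+|T_0|+|T_1|+(n+1)+|L|$. The squares of $\langle a,b,c,d\rangle$ are upper left, upper right, lower left, lower right; $\langle a,b,c,d\rangle$ may stand directly to the left of a tile $\langle b,e,d,f\rangle$ and directly above a tile $\langle c,d,e,f\rangle$. A correct partial tiling is a rectangle of $k\ge1$ rows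 of $2^n$ tiles in which all horizontally and vertically adjacent tiles match, the first row is $t_0,\dots,t_n$ padded out with $\langle\Box,\Box,\Box,\Box\rangle$, and the upper, left and right edges are white; it is a correctly tiled corridor if moreover its last row consists of tiles from $L$ and its lower edge is white. Starting from the initial row, Prover and Spoiler alternate, Prover first; in a move a player chooses $T_0$ or $T_1$ and appends one row of tiles from the chosen set such that the tiling remains a correct partial tiling. Prover wins when a correctly tiled corridor is reached (the play then ends), otherwise Spoiler wins (in particular if the play lasts forever). $G$ is well-formed if for every partial tiling reached in a play that is not a correctly tiled corridor, exactly one such row can be built from $T_0$ and exactly one from $T_1$. **The formula.** Let $\mathcal T=T_0\cup T_1\cup\{t_0,\dots,t_n,w\}$ with $w=\langle\Box,\Box,\Box,\Box\rangle$. Use unary predicates $B_0,\dots,B_{n-1}$ (bits, $B_0$ least significant, of a number $\mathit{Nr}(x)<2^n$), $\mathit{tile}_t$ ($t\in C^4$), $\pi_i^c$ ($1\le i\le4$, $c\in C$), $\mathit{setT}_0,\mathit{setT}_1,\mathit{setL},\mathit{First},\mathit{Last},E,A,\mathit{move}_0,\mathit{move}_1$. The expressions in $\mathit{Nr}$ below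 abbreviate Boolean combinations of bit predicates of size polynomial in $n$. Let $\varphi_G$ be the conjunction of the following sentences. 1. Numbering: $\forall x(\neg\exists y\,y{\downarrow}x\Rightarrow\mathit{Nr}(x)=0)$; $\forall x(\mathit{Nr}(x)\ne2^n{-}1\Rightarrow\exists y\,x{\downarrow}y\wedge\forall y(x{\downarrow}y\Rightarrow\mathit{Nr}(y)=\mathit{Nr}(x)+1))$; $\forall x(\mathit{Nr}(x)=2^n{-}1\Rightarrow\forall y(x{\downarrow}y\Rightarrow\mathit{Nr}(y)=0))$. 2. Tiles and colours: each node has exactly one of the predicates $\mathit{tile}_t$, $t\in\mathcal T$; for each $i$ exactly one of the predicates $\pi_i^c$, $c\in C$; $\forall x(\mathit{tile}_t(x)\Leftrightarrow\bigwedge_{i=1}^4\pi_i^{c_i}(x))$ for each $t=\langle c_1,c_2,c_3,c_4\rangle\in\mathcal T$; $\forall x(\mathit{setT}_i(x)\Leftrightarrow\bigvee_{t\in T_i}\mathit{tile}_t(x))$ for $i=0,1$; $\forall x(\mathit{setL}(x)\Leftrightarrow\bigvee_{t\in L}\mathit{tile}_t(x))$. 3. First and last row: $\forall x(\mathit{First}(x)\Leftrightarrow\neg\exists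 y(y{\downarrow^+}x\wedge\mathit{Nr}(x)=\mathit{Nr}(y)))$; $\forall x(\mathit{Last}(x)\Leftrightarrow\neg\exists y(x{\downarrow^+}y\wedge\mathit{Nr}(x)=\mathit{Nr}(y)))$; $\forall x(\mathit{First}(x)\wedge\mathit{Nr}(x)=i\Rightarrow\mathit{tile}_{t_i}(x))$ for $0\le i\le n$; $\forall x(\mathit{First}(x)\wedge\mathit{Nr}(x)>n\Rightarrow\mathit{tile}_w(x))$; $\forall x(\mathit{First}(x)\Rightarrow\pi_1^\Box(x)\wedge\pi_2^\Box(x))$; $\forall x(\mathit{Last}(x)\Rightarrow\pi_3^\Box(x)\wedge\pi_4^\Box(x)\wedge\mathit{setL}(x))$. 4. Existential and universal rows: $\forall x(E(x)\Leftrightarrow\neg A(x))$; $\forall x(\mathit{Nr}(x)\ne0\Rightarrow\exists y(y{\downarrow}x\wedge(E(y)\Leftrightarrow E(x))))$; $\forall x(\mathit{First}(x)\Rightarrow E(x))$; $\forall x(\mathit{Nr}(x)=0\wedge\neg\mathit{First}(x)\Rightarrow\exists y(y{\downarrow}x\wedge(E(y)\Leftrightarrow A(x))))$. 5. Moves: $\forall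 x(\neg\mathit{First}(x)\Rightarrow(\mathit{move}_0(x)\Leftrightarrow\neg\mathit{move}_1(x)))$; $\forall x(\mathit{Nr}(x)\ne0\Rightarrow\exists y(y{\downarrow}x\wedge(\mathit{move}_0(y)\Leftrightarrow\mathit{move}_0(x))))$; $\forall x(\mathit{move}_i(x)\Rightarrow\mathit{setT}_i(x))$ for $i=0,1$; $\forall x(\mathit{Nr}(x)=2^n{-}1\wedge\neg\mathit{Last}(x)\wedge A(x)\Rightarrow\exists y(x{\downarrow}y\wedge\mathit{move}_0(y))\wedge\exists y(x{\downarrow}y\wedge\mathit{move}_1(y)))$. 6. Horizontal adjacency: $\forall x(\mathit{Nr}(x)=0\Rightarrow\pi_1^\Box(x)\wedge\pi_3^\Box(x))$; $\forall x(\mathit{Nr}(x)=2^n{-}1\Rightarrow\pi_2^\Box(x)\wedge\pi_4^\Box(x))$; $\forall x(\mathit{Nr}(x)\ne0\wedge\pi_i^c(x)\Rightarrow\exists y(y{\downarrow}x\wedge\pi_{i+1}^c(y)))$ for $i\in\{1,3\}$, $c\in C$. 7. Vertical adjacency, by parity counting of colours in the same column among the ancestors: for $i\in\{1,2\}$ and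 $c\in C$, $\forall x\big(\pi_i^c(x)\Rightarrow\exists^{=\epsilon,2}y\,(y{\downarrow^+}x\wedge\mathit{Nr}(y)=\mathit{Nr}(x)\wedge\neg(\pi_i^c(y)\Leftrightarrow\pi_{i+2}^c(y)))\big)$, where $\epsilon=0$ if $c=\Box$ and $\epsilon=1$ otherwise. **Theorem.** There is a polynomial $p$ such that for every well-formed tiling game $G$ the sentence $\varphi_G$ of $\mathrm{FO}^2_{\mathrm{MOD}}[\downarrow,\downarrow^+]$ has size at most $p(|G|)$, and Prover has a winning strategy in $G$ if and only if $\varphi_G$ is satisfiable over finite trees. -/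

import Mathlib

/-! ## The logic: two variables, modulo counting, child and descendant -/

/-- The two variables. -/
inductive Var : Type
  | x
  | y
  deriving DecidableEq

/-- The comparison in a modulo counting quantifier. -/
inductive ModCmp : Type
  | le
  | eq
  | ge

def ModCmp.Holds : ModCmp → ℕ → ℕ → Prop
  | .le, a, b => a ≤ b
  | .eq, a, b => a = b
  | .ge, a, b => a ≥ b

/-- Two-variable first-order formulas with modulo counting quantifiers over the unary symbols `P`
and the binary symbols `child` and `desc`. In `exMod c k v φ` with `k : Fin l` the modulus is `l`
(so `l` is positive and `k < l`). -/
inductive Formula (P : Type) : Type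
  | tru : Formula P
  | fls : Formula P
  | pred (p : P) (v : Var) : Formula P
  | eq (v w : Var) : Formula P
  | child (v w : Var) : Formula P
  | desc (v w : Var) : Formula P
  | neg (φ : Formula P) : Formula P
  | and (φ ψ : Formula P) : Formula P
  | or (φ ψ : Formula P) : Formula P
  | imp (φ ψ : Formula P) : Formula P
  | iff (φ ψ : Formula P) : Formula P
  | all (v : Var) (φ : Formula P) : Formula P
  | ex (v : Var) (φ : Formula P) : Formula P
  | exMod (c : ModCmp) {l : ℕ} (k : Fin l) (v : Var) (φ : Formula P) : Formula P

/-- A finite rooted tree. `child u v` says that `v` is a child of `u`. (Siblings carry no order: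
the formulas considered here cannot mention it.) -/
structure FiniteTree where
  Node : Type
  finite : Finite Node
  root : Node
  child : Node → Node → Prop
  root_no_parent : ∀ u, ¬ child u root
  parent_unique : ∀ u u' v, child u v → child u' v → u = u'
  reachable : ∀ v, Relation.ReflTransGen child root v

/-- A finite tree whose nodes are labelled by arbitrary sets of unary predicates from `P`. -/
structure LabelledTree (P : Type) extends FiniteTree where
  label : P → Node → Prop

namespace Formula

variable {P : Type}

/-- Truth of a formula in a labelled tree; `desc` is the transitive closure of `child`. -/
def Sat (M : LabelledTree P) : Formula P → (Var → M.Node) → Prop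
  | tru, _ => True
  | fls, _ => False
  | pred p v, s => M.label p (s v)
  | eq v w, s => s v = s w
  | child v w, s => M.child (s v) (s w)
  | desc v w, s => Relation.TransGen M.child (s v) (s w)
  | neg φ, s => ¬ Sat M φ s
  | and φ ψ, s => Sat M φ s ∧ Sat M ψ s
  | or φ ψ, s => Sat M φ s ∨ Sat M ψ s
  | imp φ ψ, s => Sat M φ s → Sat M ψ s
  | iff φ ψ, s => (Sat M φ s ↔ Sat M ψ s)
  | all v φ, s => ∀ b : M.Node, Sat M φ (Function.update s v b)
  | ex v φ, s => ∃ b : M.Node, Sat M φ (Function.update s v b)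
  | @exMod _ c l k v φ, s =>
      c.Holds (Set.ncard {b : M.Node | Sat M φ (Function.update s v b)} % l) k

/-- Length of a formula, with the numbers in modulo quantifiers written in binary. -/
def size : Formula P → ℕ
  | tru => 1
  | fls => 1
  | pred _ _ => 2
  | eq _ _ => 3
  | child _ _ => 3
  | desc _ _ => 3
  | neg φ => 1 + size φ
  | and φ ψ => 1 + size φ + size ψ
  | or φ ψ => 1 + size φ + size ψ
  | imp φ ψ => 1 + size φ + size ψ
  | iff φ ψ => 1 + size φ + size ψ
  | all _ φ => 2 + size φ
  | ex _ φ => 2 + size φ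
  | @exMod _ _ l k _ φ => 3 + Nat.size k + Nat.size l + size φ

/-- `v` occurs free in the formula. -/
def HasFree : Formula P → Var → Prop
  | tru, _ => False
  | fls, _ => False
  | pred _ w, v => v = w
  | eq w w', v => v = w ∨ v = w'
  | child w w', v => v = w ∨ v = w'
  | desc w w', v => v = w ∨ v = w'
  | neg φ, v => HasFree φ v
  | and φ ψ, v => HasFree φ v ∨ HasFree ψ v
  | or φ ψ, v => HasFree φ v ∨ HasFree ψ v
  | imp φ ψ, v => HasFree φ v ∨ HasFree ψ v
  | iff φ ψ, v => HasFree φ v ∨ HasFree ψ v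
  | all w φ, v => v ≠ w ∧ HasFree φ v
  | ex w φ, v => v ≠ w ∧ HasFree φ v
  | exMod _ _ w φ, v => v ≠ w ∧ HasFree φ v

def IsSentence (φ : Formula P) : Prop := ∀ v, ¬ φ.HasFree v

/-- Satisfiability over finite trees (of a sentence, so the assignment is irrelevant). -/
def FinTreeSatisfiable (φ : Formula P) : Prop :=
  ∃ M : LabelledTree P, ∀ s : Var → M.Node, φ.Sat M s

/-- Finite conjunctions. -/
def conj : List (Formula P) → Formula P
  | [] => tru
  | φ :: l => and φ (conj l)

/-- Finite disjunctions. -/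
def disj : List (Formula P) → Formula P
  | [] => fls
  | φ :: l => or φ (disj l)

end Formula

/-! ## Tiling games -/

/-- A tile `⟨a, b, c, d⟩`: the colours of its four squares, in the order
upper left, upper right, lower left, lower right (positions `0, 1, 2, 3`). -/
abbrev Tile (C : Type) : Type := Fin 4 → C

/-- Horizontal adjacency: `⟨a,b,c,d⟩` is directly to the left of `⟨b,e,d,f⟩`. -/
def Tile.HAdj {C : Type} (t t' : Tile C) : Prop := t 1 = t' 0 ∧ t 3 = t' 2

/-- Vertical adjacency: `⟨a,b,c,d⟩` is directly above `⟨c,d,e,f⟩`. -/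
def Tile.VAdj {C : Type} (t t' : Tile C) : Prop := t 2 = t' 0 ∧ t 3 = t' 1

/-- Tiling games `⟨C, T₀, T₁, n, ⟨t₀, …, tₙ⟩, □, L⟩`. -/
structure TilingGame where
  Color : Type
  [fintypeColor : Fintype Color]
  [decEqColor : DecidableEq Color]
  T : Fin 2 → Finset (Tile Color)
  n : ℕ
  init : Fin (n + 1) → Tile Color
  white : Color
  L : Finset (Tile Color)
  L_subset : L ⊆ T 0 ∪ T 1

attribute [instance] TilingGame.fintypeColor TilingGame.decEqColor

namespace TilingGame

variable (G : TilingGame)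

/-- The number of colours plus the numbers of tiles listed in the components of the game. (The
number `n` is counted in unary, as the initial sequence is part of the game.) -/
def size : ℕ :=
  Fintype.card G.Color + (G.T 0).card + (G.T 1).card + (G.n + 1) + G.L.card

/-- The all-white tile. -/
def whiteTile : Tile G.Color := fun _ => G.white

/-- Rows have `2 ^ n` tiles. -/
abbrev Row : Type := Fin (2 ^ G.n) → Tile G.Color

/-- The initial row: `t₀, …, tₙ` padded out with white tiles. -/
def initRow : G.Row := fun j =>
  if h : (j : ℕ) < G.n + 1 then G.init ⟨j, h⟩ else G.whiteTile

/-- A row is horizontally correct, with white left and right ends. -/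
def RowCorrect (r : G.Row) : Prop :=
  (∀ j j' : Fin (2 ^ G.n), (j' : ℕ) = j + 1 → Tile.HAdj (r j) (r j')) ∧
  (∀ j : Fin (2 ^ G.n), (j : ℕ) = 0 → r j 0 = G.white ∧ r j 2 = G.white) ∧
  (∀ j : Fin (2 ^ G.n), (j : ℕ) + 1 = 2 ^ G.n → r j 1 = G.white ∧ r j 3 = G.white)

/-- A correct partial tiling, listed row by row from the top: it has all properties of a correctly
tiled corridor except those concerning its last row. -/
def PartialTiling (ρ : List G.Row) : Prop :=
  ρ.head? = some G.initRow ∧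
  (∀ j, G.initRow j 0 = G.white ∧ G.initRow j 1 = G.white) ∧
  (∀ r ∈ ρ, G.RowCorrect r) ∧
  ρ.IsChain (fun r r' => ∀ j, Tile.VAdj (r j) (r' j))

/-- Correctly tiled corridors: moreover the last row consists of tiles from `L` and its lower edge
is white. -/
def Corridor (ρ : List G.Row) : Prop :=
  G.PartialTiling ρ ∧
  ∀ r, ρ.getLast? = some r → ∀ j, r j ∈ G.L ∧ r j 2 = G.white ∧ r j 3 = G.white

/-- The row `r`, built from the tiles of `T i`, correctly extends the tiling `ρ`. -/
def CanBuild (ρ : List G.Row) (i : Fin 2) (r : G.Row) : Prop :=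
  (∀ j, r j ∈ G.T i) ∧ G.PartialTiling (ρ ++ [r])

/-- A move: choose one of the two sets and build a row from it. -/
def Move (ρ : List G.Row) (r : G.Row) : Prop := ∃ i, G.CanBuild ρ i r

/-- The (finite) plays, given by the rows constructed so far; a play ends as soon as there is a
correctly tiled corridor. -/
inductive Play : List G.Row → Prop
  | start : Play [G.initRow]
  | move {ρ : List G.Row} {r : G.Row} :
      Play ρ → ¬ G.Corridor ρ → G.Move ρ r → Play (ρ ++ [r])

/-- Well-formed games: in every incomplete play exactly one new row can be built from `T₀` and
exactly one from `T₁`. -/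
def WellFormed : Prop :=
  ∀ ρ, G.Play ρ → ¬ G.Corridor ρ → ∀ i, ∃! r, G.CanBuild ρ i r

/-- Prover moves first, that is, when only the initial row is present; then the players
alternate. -/
def ProverTurn (ρ : List G.Row) : Prop := Odd ρ.length

/-- The plays in which Prover's moves are those given by the strategy `σ`. -/
inductive Follows (σ : List G.Row → G.Row) : List G.Row → Prop
  | start : Follows σ [G.initRow]
  | prover {ρ : List G.Row} : Follows σ ρ → ¬ G.Corridor ρ → G.ProverTurn ρ →
      G.Move ρ (σ ρ) → Follows σ (ρ ++ [σ ρ])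
  | spoiler {ρ : List G.Row} {r : G.Row} : Follows σ ρ → ¬ G.Corridor ρ → ¬ G.ProverTurn ρ →
      G.Move ρ r → Follows σ (ρ ++ [r])

/-- The strategy `σ` wins: no play that follows it gets stuck before there is a correctly tiled
corridor, and none lasts forever. -/
def Wins (σ : List G.Row → G.Row) : Prop :=
  (∀ ρ, G.Follows σ ρ → ¬ G.Corridor ρ → ∃ r, G.Follows σ (ρ ++ [r])) ∧
  ¬ ∃ π : ℕ → G.Row, ∀ k, G.Follows σ ((List.range (k + 1)).map π)

/-- Prover has a winning strategy. -/
def ProverWins : Prop := ∃ σ, G.Wins σ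

/-! ## The formula of a game -/

/-- The unary predicates of the formula: the bits of the column number, the tile at a node, the
four colours of that tile, membership of the tile in `T₀`, `T₁`, `L`, first and last row,
existential and universal row, and the set chosen when the row was built. -/
inductive Symbol : Type
  | bit (i : Fin G.n)
  | tile (t : Tile G.Color)
  | color (i : Fin 4) (c : G.Color)
  | setT (i : Fin 2)
  | setL
  | first
  | last
  | exi
  | uni
  | move (i : Fin 2)

/-- Formulas over the symbols of `G`. -/
abbrev Fml : Type := Formula G.Symbol

open Formula

variable {G}


/-- The number of `v` is the constant `k` (meant for `k < 2 ^ n`). -/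
def nrEq (v : Var) (k : ℕ) : G.Fml :=
  conj ((List.finRange G.n).map fun (i : Fin G.n) =>
    if k.testBit i then pred (.bit i) v else neg (pred (.bit i) v))

/-- `v` and `w` have the same number. -/
def nrSame (v w : Var) : G.Fml :=
  conj ((List.finRange G.n).map fun i => iff (pred (.bit i) v) (pred (.bit i) w))

/-- The number of `v` is the number of `w` plus one. -/
def nrSucc (v w : Var) : G.Fml :=
  disj ((List.finRange G.n).map fun i =>
    and (and (pred (.bit i) v) (neg (pred (.bit i) w)))
      (conj ((List.finRange G.n).map fun j =>
        if j < i then and (neg (pred (.bit j) v)) (pred (.bit j) w)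
        else if i < j then iff (pred (.bit j) v) (pred (.bit j) w)
        else tru)))

/-- The number of `v` is greater than `n`. -/
def nrGtN (v : Var) : G.Fml :=
  conj ((List.range (G.n + 1)).map fun k => neg (nrEq v k))

/-- `v` is in the last column. -/
def lastCol (v : Var) : G.Fml := nrEq v (2 ^ G.n - 1)

/-- The `i`-th square of the tile at `v` is white. -/
def isWhite (i : Fin 4) (v : Var) : G.Fml := pred (.color i G.white) v

variable (G)

/-- All tiles occurring in the game. -/
def tiles : Finset (Tile G.Color) :=
  G.T 0 ∪ G.T 1 ∪ Finset.univ.image G.init ∪ {G.whiteTile}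

/-- Numbering of nodes. -/
noncomputable def numbering : G.Fml := conj [
  all .x (imp (neg (ex .y (child .y .x))) (nrEq .x 0)),
  all .x (imp (neg (lastCol .x))
    (and (ex .y (child .x .y)) (all .y (imp (child .x .y) (nrSucc .y .x))))),
  all .x (imp (lastCol .x) (all .y (imp (child .x .y) (nrEq .y 0))))]

/-- Tiles and colours. -/
noncomputable def tilesAndColors : G.Fml := conj [
  all .x (disj (G.tiles.toList.map fun t =>
    and (pred (.tile t) .x)
      (conj ((G.tiles.erase t).toList.map fun t' => neg (pred (.tile t') .x))))),
  all .x (conj ((List.finRange 4).map fun i =>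
    disj ((Finset.univ : Finset G.Color).toList.map fun c =>
      and (pred (.color i c) .x)
        (conj (((Finset.univ : Finset G.Color).erase c).toList.map fun c' =>
          neg (pred (.color i c') .x)))))),
  conj (G.tiles.toList.map fun t =>
    all .x (iff (pred (.tile t) .x)
      (conj ((List.finRange 4).map fun i => pred (.color i (t i)) .x)))),
  conj ((List.finRange 2).map fun i =>
    all .x (iff (disj ((G.T i).toList.map fun t => pred (.tile t) .x)) (pred (.setT i) .x))),
  all .x (iff (disj (G.L.toList.map fun t => pred (.tile t) .x)) (pred .setL .x))]

/-- First and last row. -/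
noncomputable def firstAndLastRow : G.Fml := conj [
  all .x (iff (pred .first .x) (neg (ex .y (and (desc .y .x) (nrSame .x .y))))),
  all .x (iff (pred .last .x) (neg (ex .y (and (desc .x .y) (nrSame .x .y))))),
  conj ((List.finRange (G.n + 1)).map fun (i : Fin (G.n + 1)) =>
    all .x (imp (and (pred .first .x) (nrEq .x i)) (pred (.tile (G.init i)) .x))),
  all .x (imp (and (pred .first .x) (nrGtN .x)) (pred (.tile G.whiteTile) .x)),
  all .x (imp (pred .first .x) (and (isWhite 0 .x) (isWhite 1 .x))),
  all .x (imp (pred .last .x) (and (and (isWhite 2 .x) (isWhite 3 .x)) (pred .setL .x)))]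

/-- Existential and universal rows. -/
noncomputable def existentialAndUniversalRows : G.Fml := conj [
  all .x (iff (pred .exi .x) (neg (pred .uni .x))),
  all .x (imp (neg (nrEq .x 0))
    (ex .y (and (child .y .x) (iff (pred .exi .y) (pred .exi .x))))),
  all .x (imp (pred .first .x) (pred .exi .x)),
  all .x (imp (and (nrEq .x 0) (neg (pred .first .x)))
    (ex .y (and (child .y .x) (iff (pred .exi .y) (pred .uni .x)))))]

/-- Universal rows have two successors. -/
noncomputable def universalRowsHaveTwoSuccessors : G.Fml := conj [
  all .x (imp (neg (pred .first .x)) (iff (pred (.move 0) .x) (neg (pred (.move 1) .x)))),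
  all .x (imp (neg (nrEq .x 0))
    (ex .y (and (child .y .x) (iff (pred (.move 0) .y) (pred (.move 0) .x))))),
  all .x (imp (pred (.move 0) .x) (pred (.setT 0) .x)),
  all .x (imp (pred (.move 1) .x) (pred (.setT 1) .x)),
  all .x (imp (and (lastCol .x) (and (neg (pred .last .x)) (pred .uni .x)))
    (and (ex .y (and (child .x .y) (pred (.move 0) .y)))
      (ex .y (and (child .x .y) (pred (.move 1) .y)))))]

/-- Horizontal adjacency. -/
noncomputable def horizontalAdjacency : G.Fml := conj [
  all .x (imp (nrEq .x 0) (and (isWhite 0 .x) (isWhite 2 .x))),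
  all .x (imp (lastCol .x) (and (isWhite 1 .x) (isWhite 3 .x))),
  conj ((Finset.univ : Finset G.Color).toList.map fun c =>
    all .x (imp (and (neg (nrEq .x 0)) (pred (.color 0 c) .x))
      (ex .y (and (child .y .x) (pred (.color 1 c) .y))))),
  conj ((Finset.univ : Finset G.Color).toList.map fun c =>
    all .x (imp (and (neg (nrEq .x 0)) (pred (.color 2 c) .x))
      (ex .y (and (child .y .x) (pred (.color 3 c) .y)))))]

/-- The node `y` is an ancestor of `x` in the same column and exactly one of the squares `i`, `i'`
of its tile has the colour `c`. -/
noncomputable def oddAbove (i i' : Fin 4) (c : G.Color) : G.Fml :=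
  and (desc .y .x) (and (nrSame .y .x)
    (neg (iff (pred (.color i c) .y) (pred (.color i' c) .y))))

/-- Vertical adjacency: the number of occurrences of a colour on the left (right) ends of the
horizontal edges of the ancestors of `x` in the same column is even if the colour is white, odd
otherwise, whenever the upper left (right) square of `x` has this colour. A tile that carries the
colour both above and below has two occurrences and does not affect the parity. -/
noncomputable def verticalAdjacency : G.Fml := conj [
  all .x (imp (isWhite 0 .x) (exMod .eq (0 : Fin 2) .y (G.oddAbove 0 2 G.white))),
  all .x (imp (isWhite 1 .x) (exMod .eq (0 : Fin 2) .y (G.oddAbove 1 3 G.white))),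
  conj (((Finset.univ : Finset G.Color).erase G.white).toList.map fun c =>
    all .x (imp (pred (.color 0 c) .x) (exMod .eq (1 : Fin 2) .y (G.oddAbove 0 2 c)))),
  conj (((Finset.univ : Finset G.Color).erase G.white).toList.map fun c =>
    all .x (imp (pred (.color 1 c) .x) (exMod .eq (1 : Fin 2) .y (G.oddAbove 1 3 c))))]

/-- The formula of the game. -/
noncomputable def formula : G.Fml := conj [
  G.numbering, G.tilesAndColors, G.firstAndLastRow, G.existentialAndUniversalRows,
  G.universalRowsHaveTwoSuccessors, G.horizontalAdjacency, G.verticalAdjacency]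

end TilingGame

/-! A model of the formula is a strategy tree for Prover. The numbering forces `Nr` to be the depth
modulo `2 ^ n`, so every branch falls into blocks of `2 ^ n` levels; a block spells one row, column
by column, and a sequence of blocks spells a play. Below the end of an existential row one
continuation is enough, since Prover chooses; below a universal row that is not the last,
continuations from both sets are demanded. `IsModel` collects these conditions, and `sat_formula`
identifies them with truth of the formula.

The delicate condition is vertical matching, which relates a node to the one `2 ^ n` levels higher.
Parity replaces access to that node. Follow one half of a column downwards and fix a colour `c`. An
ancestor counts when exactly one of its upper and lower squares is `c`, that is, when the statement
"the current edge has colour `c`" changes its truth value. As the top edge is white and the edges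
above match, the count has the parity of [`c` is white] + [the current edge is `c`]. Taking for `c`
the upper colour of `x`, the prescribed parity holds exactly when the edge above `x` has that
colour. Induction on the depth gives `parity_iff_vertical`.

From a model to a strategy (`winIn_rowsAt`): Prover moves down the tree. By well-formedness the row
Spoiler builds from a set is the only one possible, hence the one the tree provides for that set.
The finite depth bounds the number of moves, so Prover wins in the sense of `WinIn`, and moving to a
nearest win is a winning strategy.

From a strategy to a model (`isModel_playModel`): finitely many rows exist, so by Kőnig's lemma the
plays following a winning strategy have bounded length and are finitely many. Pairs of such a play
and a column form the tree. Plays record the chosen set, because a row may be buildable from both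
sets while the move labels exclude each other. -/

namespace Formula

/-! ### Finite conjunctions and disjunctions -/

variable {P : Type}

@[simp]
theorem sat_conj (M : LabelledTree P) (l : List (Formula P)) (s : Var → M.Node) :
    (conj l).Sat M s ↔ ∀ φ ∈ l, φ.Sat M s := by
  induction l with
  | nil => simp [conj, Sat]
  | cons φ l ih => simp [conj, Sat, ih]

@[simp]
theorem sat_disj (M : LabelledTree P) (l : List (Formula P)) (s : Var → M.Node) :
    (disj l).Sat M s ↔ ∃ φ ∈ l, φ.Sat M s := by
  induction l with
  | nil => simp [disj, Sat]
  | cons φ l ih => simp [disj, Sat, ih]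

theorem hasFree_conj (l : List (Formula P)) (v : Var) :
    (conj l).HasFree v ↔ ∃ φ ∈ l, φ.HasFree v := by
  induction l with
  | nil => simp [conj, HasFree]
  | cons φ l ih => simp [conj, HasFree, ih]

theorem hasFree_disj (l : List (Formula P)) (v : Var) :
    (disj l).HasFree v ↔ ∃ φ ∈ l, φ.HasFree v := by
  induction l with
  | nil => simp [disj, HasFree]
  | cons φ l ih => simp [disj, HasFree, ih]

end Formula

/-! ### Equality and successor in binary -/

theorem Nat.eq_iff_testBit_of_lt_two_pow {n a b : ℕ} (ha : a < 2 ^ n) (hb : b < 2 ^ n) :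
    a = b ↔ ∀ i : Fin n, (a.testBit i = true ↔ b.testBit i = true) := by
  constructor
  · rintro rfl i
    rfl
  · intro h
    apply Nat.eq_of_testBit_eq
    intro j
    by_cases hj : j < n
    · exact Bool.eq_iff_iff.2 (h ⟨j, hj⟩)
    · have : 2 ^ n ≤ 2 ^ j := Nat.pow_le_pow_right (by omega) (by omega)
      rw [Nat.testBit_lt_two_pow (by omega), Nat.testBit_lt_two_pow (by omega)]

/-- Adding one clears the trailing ones of `b` and sets the lowest zero, at position `i`. The
induction splits off the lowest bit: either the carry stops there, or it passes on to the halves. -/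
theorem Nat.eq_add_one_iff_testBit (n : ℕ) : ∀ a b : ℕ, a < 2 ^ n → b < 2 ^ n →
    (a = b + 1 ↔ ∃ i < n, (a.testBit i = true ∧ b.testBit i = false) ∧
      ∀ j < n, (j < i → a.testBit j = false ∧ b.testBit j = true) ∧
        (i < j → a.testBit j = b.testBit j)) := by
  induction n with
  | zero => intro a b ha hb; simp at *; omega
  | succ n ih =>
    intro a b ha hb
    have ih' := ih (a / 2) (b / 2) (by omega) (by omega)
    have ext : a / 2 = b / 2 ↔ ∀ j < n, a.testBit (j + 1) = b.testBit (j + 1) := by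
      constructor
      · intro h j _
        simp [Nat.testBit_add_one, h]
      · intro h
        apply Nat.eq_of_testBit_eq
        intro j
        by_cases hj : j < n
        · simpa [Nat.testBit_add_one] using h j hj
        · have : 2 ^ n ≤ 2 ^ j := Nat.pow_le_pow_right (by omega) (by omega)
          rw [Nat.testBit_lt_two_pow (by omega), Nat.testBit_lt_two_pow (by omega)]
    have key : a = b + 1 ↔ (a % 2 = 1 ∧ b % 2 = 0 ∧ a / 2 = b / 2) ∨
        (a % 2 = 0 ∧ b % 2 = 1 ∧ a / 2 = b / 2 + 1) := by omega
    rw [key, ih', ext]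
    constructor
    · rintro (⟨h1, h2, h3⟩ | ⟨h1, h2, i, hi, h3, h4⟩)
      · refine ⟨0, by omega, by simp [Nat.testBit_zero, h1, h2], fun j hj => ⟨by omega, fun h => ?_⟩⟩
        obtain ⟨j, rfl⟩ := Nat.exists_eq_succ_of_ne_zero (by omega : j ≠ 0)
        exact h3 j (by omega)
      · refine ⟨i + 1, by omega, by simpa [Nat.testBit_add_one] using h3, fun j hj => ?_⟩
        cases j with
        | zero => simp [Nat.testBit_zero, h1, h2]
        | succ j => simpa [Nat.testBit_add_one] using h4 j (by omega)
    · rintro ⟨i, hi, h3, h4⟩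
      cases i with
      | zero =>
        left
        simp only [Nat.testBit_zero, decide_eq_true_eq, decide_eq_false_iff_not] at h3
        exact ⟨h3.1, by omega, fun j hj => (h4 (j + 1) (by omega)).2 (by omega)⟩
      | succ i =>
        right
        have h0 := (h4 0 (by omega)).1 (by omega)
        simp only [Nat.testBit_zero, decide_eq_true_eq, decide_eq_false_iff_not] at h0
        refine ⟨by omega, h0.2, i, by omega, by simpa [Nat.testBit_add_one] using h3, fun j hj => ?_⟩
        simpa [Nat.testBit_add_one] using h4 (j + 1) (by omega)

/-! ### Meaning of the conjuncts -/

namespace TilingGame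

open Formula

variable {G : TilingGame}

open Classical in
/-- The number of a node, given by its bits. -/
noncomputable def nr (M : LabelledTree G.Symbol) (x : M.Node) : ℕ :=
  Nat.ofBits fun i : Fin G.n => decide (M.label (.bit i) x)

theorem nr_lt (M : LabelledTree G.Symbol) (x : M.Node) : nr M x < 2 ^ G.n :=
  Nat.ofBits_lt_two_pow _

theorem testBit_nr (M : LabelledTree G.Symbol) (x : M.Node) (i : Fin G.n) :
    (nr M x).testBit i = true ↔ M.label (.bit i) x := by
  simp [nr, Nat.testBit_ofBits_lt]

theorem sat_nrEq {M : LabelledTree G.Symbol} {s : Var → M.Node} {v : Var} {k : ℕ}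
    (hk : k < 2 ^ G.n) : (nrEq v k).Sat M s ↔ nr M (s v) = k := by
  rw [Nat.eq_iff_testBit_of_lt_two_pow (nr_lt M _) hk]
  simp only [nrEq, sat_conj, List.mem_map, List.mem_finRange, true_and, forall_exists_index,
    forall_apply_eq_imp_iff, testBit_nr]
  refine forall_congr' fun i => ?_
  by_cases h : k.testBit i <;> simp [h, Sat]

@[simp]
theorem sat_nrEq_zero {M : LabelledTree G.Symbol} {s : Var → M.Node} {v : Var} :
    (nrEq v 0).Sat M s ↔ nr M (s v) = 0 :=
  sat_nrEq (by positivity)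

@[simp]
theorem sat_lastCol {M : LabelledTree G.Symbol} {s : Var → M.Node} {v : Var} :
    (lastCol v).Sat M s ↔ nr M (s v) = 2 ^ G.n - 1 :=
  sat_nrEq (Nat.sub_lt (by positivity) one_pos)

@[simp]
theorem sat_nrSame {M : LabelledTree G.Symbol} {s : Var → M.Node} {v w : Var} :
    (nrSame v w).Sat M s ↔ nr M (s v) = nr M (s w) := by
  rw [Nat.eq_iff_testBit_of_lt_two_pow (nr_lt M _) (nr_lt M _)]
  simp [nrSame, testBit_nr, Sat]

@[simp]
theorem sat_nrSucc {M : LabelledTree G.Symbol} {s : Var → M.Node} {v w : Var} :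
    (nrSucc v w).Sat M s ↔ nr M (s v) = nr M (s w) + 1 := by
  rw [Nat.eq_add_one_iff_testBit G.n _ _ (nr_lt M _) (nr_lt M _)]
  simp only [nrSucc, sat_disj, List.mem_map, List.mem_finRange, true_and, exists_exists_eq_and,
    Sat, sat_conj, forall_exists_index, forall_apply_eq_imp_iff]
  rw [Fin.exists_iff]
  simp only [← exists_prop]
  refine exists_congr fun i => exists_congr fun hi => ?_
  simp only [exists_prop]
  refine and_congr ?_ ?_
  · rw [← testBit_nr, ← testBit_nr, Bool.not_eq_true]
  · rw [Fin.forall_iff]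
    refine forall_congr' fun j => forall_congr' fun hj => ?_
    have hv := testBit_nr M (s v) ⟨j, hj⟩
    have hw := testBit_nr M (s w) ⟨j, hj⟩
    simp only at hv hw
    rcases lt_trichotomy j i with h | h | h
    · simp [h, Sat, h.not_gt, ← hv, ← hw]
    · simp [h, Sat]
    · simp [h, Sat, h.not_gt, ← hv, ← hw]

@[simp]
theorem sat_nrGtN {M : LabelledTree G.Symbol} {s : Var → M.Node} {v : Var} :
    (nrGtN v).Sat M s ↔ G.n < nr M (s v) := by
  -- Since `n < 2 ^ n`, all the constants up to `n` are representable by the bits.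
  have h : ∀ k < G.n + 1, ((nrEq v k).Sat M s ↔ nr M (s v) = k) := fun k hk =>
    sat_nrEq (lt_of_lt_of_le hk Nat.lt_two_pow_self)
  simp only [nrGtN, sat_conj, List.mem_map, List.mem_range, forall_exists_index, and_imp,
    forall_apply_eq_imp_iff₂, Sat]
  constructor
  · intro h'
    by_contra hlt
    exact h' _ (by omega) ((h _ (by omega)).2 rfl)
  · intro h' k hk hs
    have := (h k hk).1 hs
    omega

theorem sat_numbering {M : LabelledTree G.Symbol} {s : Var → M.Node} :
    G.numbering.Sat M s ↔
      (∀ x, (¬ ∃ y, M.child y x) → nr M x = 0) ∧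
      (∀ x, nr M x ≠ 2 ^ G.n - 1 →
        (∃ y, M.child x y) ∧ ∀ y, M.child x y → nr M y = nr M x + 1) ∧
      ∀ x, nr M x = 2 ^ G.n - 1 → ∀ y, M.child x y → nr M y = 0 := by
  simp [numbering, Sat]

/-- The function `τ` is read off the colour predicates, of which exactly one holds per square. The
tile predicates are then determined, and having some tile puts `τ x` in `G.tiles`. The remaining
conjuncts are expressed through this `τ`. -/
theorem sat_tilesAndColors {M : LabelledTree G.Symbol} {s : Var → M.Node} :
    G.tilesAndColors.Sat M s ↔ ∃ τ : M.Node → Tile G.Color,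
      (∀ x i c, M.label (.color i c) x ↔ τ x i = c) ∧
      (∀ x, τ x ∈ G.tiles) ∧
      (∀ x, ∀ t ∈ G.tiles, M.label (.tile t) x ↔ τ x = t) ∧
      (∀ x i, M.label (.setT i) x ↔ τ x ∈ G.T i) ∧
      (∀ x, M.label .setL x ↔ τ x ∈ G.L) := by
  have hT : ∀ i : Fin 2, G.T i ⊆ G.tiles := by
    intro i t ht
    fin_cases i <;> simp_all [tiles]
  have hL : G.L ⊆ G.tiles := by
    intro t ht
    have := G.L_subset ht
    simp only [Finset.mem_union] at this
    rcases this with h | h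
    exacts [hT _ h, hT _ h]
  simp only [tilesAndColors, sat_conj, List.mem_cons, List.not_mem_nil, or_false, forall_eq_or_imp,
    forall_eq, Sat, sat_disj, List.mem_map, List.mem_finRange, true_and, Finset.mem_toList,
    forall_exists_index, exists_exists_and_eq_and, and_imp, forall_apply_eq_imp_iff₂,
    forall_apply_eq_imp_iff, Finset.mem_erase, Function.update_self, Finset.mem_univ, and_true,
    exists_exists_eq_and]
  constructor
  · rintro ⟨h1, h2, h3, h4, h5⟩
    choose τ hτ using h2
    have hc : ∀ x i c, M.label (.color i c) x ↔ τ x i = c := by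
      intro x i c
      constructor
      · intro h
        by_contra hne
        exact (hτ x i).2 c (Ne.symm hne) h
      · rintro rfl
        exact (hτ x i).1
    have ht : ∀ x, ∀ t ∈ G.tiles, M.label (.tile t) x ↔ τ x = t := by
      intro x t ht
      rw [h3 t ht x]
      simp only [hc]
      exact funext_iff.symm
    have hm : ∀ x, τ x ∈ G.tiles := by
      intro x
      obtain ⟨t, ht', h, -⟩ := h1 x
      rwa [(ht x t ht').1 h]
    refine ⟨τ, hc, hm, ht, fun x i => ?_, fun x => ?_⟩
    · rw [← h4]
      constructor
      · rintro ⟨t, ht', h⟩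
        rwa [(ht x t (hT i ht')).1 h]
      · intro h
        exact ⟨_, h, (ht x _ (hT i h)).2 rfl⟩
    · rw [← h5]
      constructor
      · rintro ⟨t, ht', h⟩
        rwa [(ht x t (hL ht')).1 h]
      · intro h
        exact ⟨_, h, (ht x _ (hL h)).2 rfl⟩
  · rintro ⟨τ, hc, hm, ht, h4, h5⟩
    refine ⟨fun x => ⟨τ x, hm x, (ht x _ (hm x)).2 rfl, ?_⟩,
      fun x i => ⟨τ x i, (hc _ _ _).2 rfl, fun c hne h => ?_⟩, fun t h x => ?_,
      fun i x => ?_, fun x => ?_⟩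
    · rintro _ t hne h rfl h'
      simp only [Sat, Function.update_self] at h'
      exact hne ((ht x t h).1 h').symm
    · exact hne ((hc _ _ _).1 h).symm
    · rw [ht x t h]
      simp only [hc]
      exact funext_iff
    · rw [h4]
      constructor
      · rintro ⟨t, ht', h⟩
        rwa [(ht x t (hT i ht')).1 h]
      · intro h
        exact ⟨_, h, (ht x _ (hT i h)).2 rfl⟩
    · rw [h5]
      constructor
      · rintro ⟨t, ht', h⟩
        rwa [(ht x t (hL ht')).1 h]
      · intro h
        exact ⟨_, h, (ht x _ (hL h)).2 rfl⟩

variable {M : LabelledTree G.Symbol} {τ : M.Node → Tile G.Color} {s : Var → M.Node}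

theorem sat_firstAndLastRow
    (hc : ∀ x i c, M.label (.color i c) x ↔ τ x i = c)
    (ht : ∀ x, ∀ t ∈ G.tiles, M.label (.tile t) x ↔ τ x = t) :
    G.firstAndLastRow.Sat M s ↔
      (∀ x, M.label .first x ↔ ¬ ∃ y, Relation.TransGen M.child y x ∧ nr M x = nr M y) ∧
      (∀ x, M.label .last x ↔ ¬ ∃ y, Relation.TransGen M.child x y ∧ nr M x = nr M y) ∧
      (∀ x, ∀ i : Fin (G.n + 1), M.label .first x → nr M x = i → τ x = G.init i) ∧
      (∀ x, M.label .first x → G.n < nr M x → τ x = G.whiteTile) ∧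
      (∀ x, M.label .first x → τ x 0 = G.white ∧ τ x 1 = G.white) ∧
      ∀ x, M.label .last x →
        (τ x 2 = G.white ∧ τ x 3 = G.white) ∧ M.label .setL x := by
  have hi : ∀ i, G.init i ∈ G.tiles := by simp [tiles]
  have hw : G.whiteTile ∈ G.tiles := by simp [tiles]
  have hnr : ∀ (i : Fin (G.n + 1)) (s : Var → M.Node),
      (nrEq Var.x (i : ℕ)).Sat M s ↔ nr M (s .x) = i := fun i s =>
    sat_nrEq (lt_of_lt_of_le i.2 Nat.lt_two_pow_self)
  simp only [firstAndLastRow, isWhite, sat_conj, List.mem_cons, List.not_mem_nil, or_false,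
    forall_eq_or_imp, forall_eq, Sat, List.mem_map, List.mem_finRange, true_and,
    forall_exists_index, forall_apply_eq_imp_iff, Function.update_self, hnr, sat_nrSame,
    sat_nrGtN, hc, ht _ _ (hi _), ht _ _ hw, and_imp, Function.update_of_ne, ne_eq, reduceCtorEq,
    not_false_eq_true]
  rw [forall_comm (β := M.Node)]

theorem sat_existentialAndUniversalRows :
    G.existentialAndUniversalRows.Sat M s ↔
      (∀ x, M.label .exi x ↔ ¬ M.label .uni x) ∧
      (∀ x, nr M x ≠ 0 → ∃ y, M.child y x ∧ (M.label .exi y ↔ M.label .exi x)) ∧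
      (∀ x, M.label .first x → M.label .exi x) ∧
      ∀ x, nr M x = 0 → ¬ M.label .first x →
        ∃ y, M.child y x ∧ (M.label .exi y ↔ M.label .uni x) := by
  simp [existentialAndUniversalRows, Sat]

theorem sat_universalRowsHaveTwoSuccessors :
    G.universalRowsHaveTwoSuccessors.Sat M s ↔
      (∀ x, ¬ M.label .first x → (M.label (.move 0) x ↔ ¬ M.label (.move 1) x)) ∧
      (∀ x, nr M x ≠ 0 → ∃ y, M.child y x ∧ (M.label (.move 0) y ↔ M.label (.move 0) x)) ∧
      (∀ x, M.label (.move 0) x → M.label (.setT 0) x) ∧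
      (∀ x, M.label (.move 1) x → M.label (.setT 1) x) ∧
      ∀ x, nr M x = 2 ^ G.n - 1 → ¬ M.label .last x → M.label .uni x →
        (∃ y, M.child x y ∧ M.label (.move 0) y) ∧ ∃ y, M.child x y ∧ M.label (.move 1) y := by
  simp [universalRowsHaveTwoSuccessors, Sat]

theorem sat_horizontalAdjacency (hc : ∀ x i c, M.label (.color i c) x ↔ τ x i = c) :
    G.horizontalAdjacency.Sat M s ↔
      (∀ x, nr M x = 0 → τ x 0 = G.white ∧ τ x 2 = G.white) ∧
      (∀ x, nr M x = 2 ^ G.n - 1 → τ x 1 = G.white ∧ τ x 3 = G.white) ∧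
      (∀ x, nr M x ≠ 0 → ∃ y, M.child y x ∧ τ y 1 = τ x 0) ∧
      ∀ x, nr M x ≠ 0 → ∃ y, M.child y x ∧ τ y 3 = τ x 2 := by
  simp [horizontalAdjacency, Sat, isWhite, hc]
  grind

/-- The ancestors of `x` in the same column for which exactly one of the squares `i`, `i'` has the
colour `c`. -/
def oddAncestors (τ : M.Node → Tile G.Color) (i i' : Fin 4) (c : G.Color) (x : M.Node) :
    Set M.Node :=
  {y | Relation.TransGen M.child y x ∧ nr M y = nr M x ∧ ¬ (τ y i = c ↔ τ y i' = c)}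

/-- Each node has only one colour per square, so the white conjunct and the conjuncts for the other
colours combine into one condition on the colour `τ x i`. -/
theorem sat_verticalAdjacency (hc : ∀ x i c, M.label (.color i c) x ↔ τ x i = c) :
    G.verticalAdjacency.Sat M s ↔
      (∀ x, (oddAncestors τ 0 2 (τ x 0) x).ncard % 2 = if τ x 0 = G.white then 0 else 1) ∧
      ∀ x, (oddAncestors τ 1 3 (τ x 1) x).ncard % 2 = if τ x 1 = G.white then 0 else 1 := by
  have hodd : ∀ i i' c x, {b | (G.oddAbove i i' c).Sat M
      (Function.update (Function.update s .x x) .y b)} = oddAncestors τ i i' c x := by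
    intro i i' c x
    ext b
    simp [oddAbove, oddAncestors, Sat, hc]
  simp only [verticalAdjacency, isWhite, sat_conj, List.mem_cons, List.not_mem_nil, or_false,
    forall_eq_or_imp, forall_eq, Sat, hc, List.mem_map, forall_exists_index, and_imp,
    forall_apply_eq_imp_iff₂, Finset.mem_toList, Finset.mem_erase, Finset.mem_univ, and_true,
    Function.update_self, hodd, ModCmp.Holds]
  constructor
  · rintro ⟨h1, h2, h3, h4⟩
    refine ⟨fun x => ?_, fun x => ?_⟩ <;> split_ifs with h
    · rw [h]
      exact h1 x h
    · exact h3 _ h x rfl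
    · rw [h]
      exact h2 x h
    · exact h4 _ h x rfl
  · rintro ⟨h1, h2⟩
    refine ⟨fun x h => ?_, fun x h => ?_, fun c hne x h => ?_, fun c hne x h => ?_⟩
    · simpa [h] using h1 x
    · simpa [h] using h2 x
    · simpa [h, hne] using h1 x
    · simpa [h, hne] using h2 x

end TilingGame

/-! ### Size of the formula and absence of free variables -/

namespace Formula

variable {P : Type}

theorem size_conj_map_le {α : Type} (l : List α) (f : α → Formula P) {m B : ℕ}
    (hm : l.length ≤ m) (h : ∀ a ∈ l, (f a).size ≤ B) :
    (conj (l.map f)).size ≤ 1 + m * (B + 1) := by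
  refine le_trans ?_ (Nat.add_le_add_left (Nat.mul_le_mul_right _ hm) 1)
  clear hm
  induction l with
  | nil => simp [conj, size]
  | cons a l ih =>
    have h1 := ih fun b hb => h b (List.mem_cons_of_mem _ hb)
    have h2 := h a List.mem_cons_self
    simp only [List.map_cons, conj, size, List.length_cons, Nat.succ_mul]
    omega

theorem size_disj_map_le {α : Type} (l : List α) (f : α → Formula P) {m B : ℕ}
    (hm : l.length ≤ m) (h : ∀ a ∈ l, (f a).size ≤ B) :
    (disj (l.map f)).size ≤ 1 + m * (B + 1) := by
  refine le_trans ?_ (Nat.add_le_add_left (Nat.mul_le_mul_right _ hm) 1)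
  clear hm
  induction l with
  | nil => simp [disj, size]
  | cons a l ih =>
    have h1 := ih fun b hb => h b (List.mem_cons_of_mem _ hb)
    have h2 := h a List.mem_cons_self
    simp only [List.map_cons, disj, size, List.length_cons, Nat.succ_mul]
    omega

end Formula

namespace TilingGame

open Formula

variable {G : TilingGame}

theorem hasFree_nrEq {v u : Var} {k : ℕ} (h : (nrEq (G := G) v k).HasFree u) : u = v := by
  simp only [nrEq, hasFree_conj, List.mem_map] at h
  obtain ⟨_, ⟨i, -, rfl⟩, h⟩ := h
  split_ifs at h <;> simpa [HasFree] using h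

theorem hasFree_nrGtN {v u : Var} (h : (nrGtN (G := G) v).HasFree u) : u = v := by
  simp only [nrGtN, hasFree_conj, List.mem_map] at h
  obtain ⟨_, ⟨i, -, rfl⟩, h⟩ := h
  exact hasFree_nrEq h

theorem isSentence_formula (G : TilingGame) : G.formula.IsSentence := by
  have hx : ¬ Var.y = Var.x := by simp
  have hy : ¬ Var.x = Var.y := by simp
  have h1 : ∀ k, ¬ (nrEq (G := G) .x k).HasFree .y := fun k h => hx (hasFree_nrEq h)
  have h2 : ∀ k, ¬ (nrEq (G := G) .y k).HasFree .x := fun k h => hy (hasFree_nrEq h)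
  have h3 : ¬ (nrGtN (G := G) .x).HasFree .y := fun h => hx (hasFree_nrGtN h)
  intro v
  cases v <;>
  simp [formula, numbering, tilesAndColors, firstAndLastRow, existentialAndUniversalRows,
    universalRowsHaveTwoSuccessors, horizontalAdjacency, verticalAdjacency, HasFree, hasFree_conj,
    hasFree_disj, h1, h2, h3, isWhite, lastCol, oddAbove]

theorem card_tiles_le (G : TilingGame) : G.tiles.card ≤ G.size := by
  -- The white tile is not listed in the game; the summand for the colours, which is positive, pays
  -- for it.
  have h0 : 0 < Fintype.card G.Color := Fintype.card_pos_iff.2 ⟨G.white⟩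
  have h1 : (Finset.univ.image G.init).card ≤ G.n + 1 := by
    simpa using Finset.card_image_le (s := Finset.univ) (f := G.init)
  have h2 := Finset.card_union_le (G.T 0 ∪ G.T 1 ∪ Finset.univ.image G.init) {G.whiteTile}
  have h3 := Finset.card_union_le (G.T 0 ∪ G.T 1) (Finset.univ.image G.init)
  have h4 := Finset.card_union_le (G.T 0) (G.T 1)
  simp only [tiles, size, Finset.card_singleton] at *
  omega

theorem n_add_one_le_size (G : TilingGame) : G.n + 1 ≤ G.size := by
  simp only [size]
  omega

theorem card_color_le_size (G : TilingGame) : Fintype.card G.Color ≤ G.size := by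
  simp only [size]
  omega

theorem card_T_le_size (G : TilingGame) (i : Fin 2) : (G.T i).card ≤ G.size := by
  fin_cases i <;> simp only [size] <;> grind

theorem card_L_le_size (G : TilingGame) : G.L.card ≤ G.size := by
  simp only [size]
  omega

theorem size_nrEq_le (v : Var) (k : ℕ) : (nrEq (G := G) v k).size ≤ 4 * G.size := by
  have h := size_conj_map_le (List.finRange G.n)
    (fun i => if k.testBit i then pred (Symbol.bit i) v else neg (pred (Symbol.bit (G := G) i) v))
    (m := G.n) (B := 3) (by simp) (fun i _ => by split_ifs <;> simp [Formula.size])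
  have := G.n_add_one_le_size
  refine h.trans ?_
  omega

theorem size_nrSame_le (v w : Var) : (nrSame (G := G) v w).size ≤ 6 * G.size := by
  have h := size_conj_map_le (List.finRange G.n)
    (fun i => iff (pred (Symbol.bit (G := G) i) v) (pred (Symbol.bit i) w))
    (m := G.n) (B := 5) (by simp) (fun i _ => by simp [Formula.size])
  have := G.n_add_one_le_size
  refine h.trans ?_
  omega

theorem size_nrSucc_le (v w : Var) : (nrSucc (G := G) v w).size ≤ 9 * (G.size * G.size) := by
  have hn := G.n_add_one_le_size
  refine (size_disj_map_le _ _ (m := G.n) (B := 8 + 7 * G.n) (by simp) fun i _ => ?_).trans ?_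
  · simp only [Formula.size]
    have h := size_conj_map_le (List.finRange G.n) (fun j : Fin G.n =>
      if j < i then and (neg (pred (Symbol.bit j) v)) (pred (Symbol.bit j) w)
        else if i < j then iff (pred (Symbol.bit j) v) (pred (Symbol.bit j) w)
        else (tru : G.Fml)) (m := G.n) (B := 6) (by simp)
        (fun j _ => by split_ifs <;> simp [Formula.size])
    omega
  · nlinarith [Nat.mul_le_mul hn hn]

theorem size_nrGtN_le (v : Var) : (nrGtN (G := G) v).size ≤ 7 * (G.size * G.size) := by
  have hn := G.n_add_one_le_size
  refine (size_conj_map_le _ _ (m := G.size) (B := 1 + 4 * G.size) (by simpa using hn)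
    fun k _ => ?_).trans ?_
  · simpa [Formula.size] using size_nrEq_le v k
  · nlinarith [Nat.mul_le_mul hn hn]

theorem size_oddAbove_le (i i' : Fin 4) (c : G.Color) :
    (G.oddAbove i i' c).size ≤ 17 * G.size := by
  have hn := G.n_add_one_le_size
  have := size_nrSame_le (G := G) .y .x
  simp only [oddAbove, Formula.size]
  omega

/-- Nothing exceeds quadratic size: the "exactly one" conditions range over pairs of tiles or
colours, `nrSucc` over pairs of bits, and `n + 1` constants of `n` bits each occur. The numerical
factors are generous. -/
theorem size_formula_le (G : TilingGame) : G.formula.size ≤ 1100 * (G.size * G.size) := by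
  have hn := G.n_add_one_le_size
  have hc := G.card_color_le_size
  have hC : ∀ c : G.Color, ((Finset.univ : Finset G.Color).erase c).toList.length ≤ G.size := by
    intro c
    rw [Finset.length_toList]
    exact (Finset.card_le_card (Finset.erase_subset _ _)).trans (by simpa using hc)
  have hC' : (Finset.univ : Finset G.Color).toList.length ≤ G.size := by simpa using hc
  have ht := G.card_tiles_le
  have hT : ∀ t, (G.tiles.erase t).toList.length ≤ G.size := by
    intro t
    rw [Finset.length_toList]
    exact (Finset.card_le_card (Finset.erase_subset _ _)).trans ht
  have hle : G.size ≤ G.size * G.size := Nat.le_mul_self _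
  have hEq := size_nrEq_le (G := G)
  have hL := hEq .x (2 ^ G.n - 1)
  have hx := hEq .x 0
  have hy := hEq .y 0
  have hSame := size_nrSame_le (G := G) .x .y
  have h1 : G.numbering.size ≤ 100 * (G.size * G.size) := by
    have hSucc := size_nrSucc_le (G := G) .y .x
    simp only [numbering, conj, Formula.size, lastCol]
    omega
  have h2 : G.tilesAndColors.size ≤ 150 * (G.size * G.size) := by
    have a1 := size_disj_map_le G.tiles.toList (fun t =>
      and (pred (Symbol.tile t) .x)
        (conj ((G.tiles.erase t).toList.map fun t' => neg (pred (Symbol.tile t') .x))))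
      (m := G.size) (B := 4 + 4 * G.size) (by simpa using ht) fun t _ => by
        have := size_conj_map_le (G.tiles.erase t).toList
          (fun t' => neg (pred (Symbol.tile t') .x)) (B := 3) (hT t) (by simp [Formula.size])
        simp only [Formula.size]
        omega
    have a2 := size_conj_map_le (List.finRange 4) (fun i =>
      disj ((Finset.univ : Finset G.Color).toList.map fun c =>
        and (pred (Symbol.color i c) .x)
          (conj (((Finset.univ : Finset G.Color).erase c).toList.map fun c' =>
            neg (pred (Symbol.color i c') .x))))) (m := 4)
      (B := 1 + G.size * (4 + 4 * G.size + 1)) (by simp) fun i _ => by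
        refine size_disj_map_le _ _ (B := 4 + 4 * G.size) hC' fun c _ => ?_
        have := size_conj_map_le ((Finset.univ : Finset G.Color).erase c).toList
          (fun c' => neg (pred (Symbol.color i c') .x)) (B := 3) (hC c) (by simp [Formula.size])
        simp only [Formula.size]
        omega
    have a3 := size_conj_map_le G.tiles.toList (fun t =>
      all .x (iff (pred (Symbol.tile t) .x)
        (conj ((List.finRange 4).map fun i => pred (Symbol.color i (t i)) .x))))
      (m := G.size) (B := 18) (by simpa using ht) fun t _ => by
        have := size_conj_map_le (List.finRange 4)
          (fun i => pred (Symbol.color i (t i)) .x) (m := 4) (B := 2) (by simp)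
          (by simp [Formula.size])
        simp only [Formula.size]
        omega
    have a4 := size_conj_map_le (List.finRange 2) (fun i =>
      all .x (iff (disj ((G.T i).toList.map fun t => pred (Symbol.tile t) .x))
        (pred (Symbol.setT i) .x))) (m := 2) (B := 6 + 3 * G.size) (by simp) fun i _ => by
        have := size_disj_map_le (G.T i).toList (fun t => pred (Symbol.tile t) .x)
          (m := G.size) (B := 2) (by simpa using G.card_T_le_size i) (by simp [Formula.size])
        simp only [Formula.size]
        omega
    have a5 := size_disj_map_le G.L.toList (fun t => pred (Symbol.tile t) .x)
      (m := G.size) (B := 2) (by simpa using G.card_L_le_size) (by simp [Formula.size])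
    simp only [tilesAndColors, conj, Formula.size]
    ring_nf at a1 a2 a3 a4 a5 hle hn ⊢
    omega
  have h3 : G.firstAndLastRow.size ≤ 150 * (G.size * G.size) := by
    have a1 := size_conj_map_le (List.finRange (G.n + 1)) (fun i : Fin (G.n + 1) =>
      all .x (imp (and (pred Symbol.first .x) (nrEq .x i)) (pred (Symbol.tile (G.init i)) .x)))
      (m := G.size) (B := 8 + 4 * G.size) (by simpa using hn) fun i _ => by
        have := hEq .x i
        simp only [Formula.size]
        omega
    have a2 := size_nrGtN_le (G := G) .x
    simp only [firstAndLastRow, conj, Formula.size, isWhite]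
    ring_nf at a1 a2 hle hn hSame ⊢
    omega
  have h4 : G.existentialAndUniversalRows.size ≤ 100 * (G.size * G.size) := by
    simp only [existentialAndUniversalRows, conj, Formula.size]
    omega
  have h5 : G.universalRowsHaveTwoSuccessors.size ≤ 150 * (G.size * G.size) := by
    simp only [universalRowsHaveTwoSuccessors, conj, Formula.size, lastCol]
    omega
  have h6 : G.horizontalAdjacency.size ≤ 150 * (G.size * G.size) := by
    have a (i j : Fin 4) := size_conj_map_le (Finset.univ : Finset G.Color).toList (fun c =>
      all .x (imp (and (neg (nrEq .x 0)) (pred (Symbol.color i c) .x))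
        (ex .y (and (child .y .x) (pred (Symbol.color j c) .y))))) (B := 15 + 4 * G.size) hC'
        fun i _ => by
          simp only [Formula.size]
          omega
    have a1 := a 0 1
    have a2 := a 2 3
    simp only [horizontalAdjacency, conj, Formula.size, lastCol, isWhite]
    ring_nf at a1 a2 hle hn hL hx ⊢
    omega
  have h7 : G.verticalAdjacency.size ≤ 200 * (G.size * G.size) := by
    have hs : Nat.size 2 = 2 := by decide
    have hs1 : Nat.size 1 = 1 := by decide
    have hs0 : Nat.size 0 = 0 := by decide
    have a (i j : Fin 4) := size_conj_map_le ((Finset.univ : Finset G.Color).erase G.white).toList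
      (fun c => all .x (imp (pred (.color i c) .x) (exMod .eq (1 : Fin 2) .y (G.oddAbove i j c))))
        (B := 11 + 17 * G.size) (hC _)
        fun c _ => by
          have := size_oddAbove_le i j c
          simp only [Formula.size, hs, Fin.val_one, hs1]
          omega
    have a1 := a 0 2
    have a2 := a 1 3
    have b1 := size_oddAbove_le 0 2 G.white
    have b2 := size_oddAbove_le 1 3 G.white
    simp only [verticalAdjacency, conj, Formula.size, isWhite, hs, Fin.val_zero, hs0]
    ring_nf at a1 a2 b1 b2 hle hn ⊢
    omega
  simp only [formula, conj, Formula.size]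
  omega

end TilingGame

/-! ### Parents, depth and ancestors in a finite tree -/

namespace FiniteTree

variable (F : FiniteTree)

open Classical in
/-- The parent of a node; the root is its own parent. -/
noncomputable def par (x : F.Node) : F.Node :=
  if h : ∃ u, F.child u x then h.choose else x

variable {F}

theorem par_eq {u x : F.Node} (h : F.child u x) : F.par x = u := by
  have h' : ∃ u, F.child u x := ⟨u, h⟩
  rw [par, dif_pos h']
  exact F.parent_unique _ _ _ h'.choose_spec h

theorem exists_par_iterate_eq_root (x : F.Node) : ∃ k, F.par^[k] x = F.root := by
  induction F.reachable x with
  | refl => exact ⟨0, rfl⟩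
  | tail _ hc ih =>
    obtain ⟨k, hk⟩ := ih
    exact ⟨k + 1, by rw [Function.iterate_succ_apply, par_eq hc, hk]⟩

open Classical in
/-- The distance of a node from the root. -/
noncomputable def depth (x : F.Node) : ℕ := Nat.find (exists_par_iterate_eq_root x)

theorem depth_root : depth F.root = 0 := by
  classical
  rw [depth, Nat.find_eq_zero]
  rfl

theorem depth_of_child {u x : F.Node} (h : F.child u x) : depth x = depth u + 1 := by
  classical
  have hx : ∀ k, F.par^[k + 1] x = F.par^[k] u := fun k => by
    rw [Function.iterate_succ_apply, par_eq h]
  have hu : F.par^[depth u] u = F.root := Nat.find_spec (exists_par_iterate_eq_root u)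
  rw [depth, Nat.find_eq_iff]
  refine ⟨by rw [hx, hu], fun k hk h' => ?_⟩
  cases k with
  | zero =>
    rw [Function.iterate_zero_apply] at h'
    exact F.root_no_parent u (h' ▸ h)
  | succ k =>
    rw [hx] at h'
    have : depth u ≤ k := Nat.find_min' _ h'
    omega

theorem child_par {x : F.Node} (h : depth x ≠ 0) : F.child (F.par x) x := by
  rcases Relation.ReflTransGen.cases_tail (F.reachable x) with rfl | ⟨u, -, hu⟩
  · exact absurd depth_root h
  · rwa [par_eq hu]

theorem child_iff {u x : F.Node} : F.child u x ↔ depth x ≠ 0 ∧ F.par x = u := by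
  constructor
  · intro h
    exact ⟨by rw [depth_of_child h]; omega, par_eq h⟩
  · rintro ⟨h, rfl⟩
    exact child_par h

theorem exists_child_iff {x : F.Node} : (∃ y, F.child y x) ↔ depth x ≠ 0 :=
  ⟨fun ⟨_, h⟩ => (child_iff.1 h).1, fun h => ⟨_, child_par h⟩⟩

theorem depth_par_iterate (x : F.Node) {k : ℕ} (hk : k ≤ depth x) :
    depth (F.par^[k] x) = depth x - k := by
  induction k with
  | zero => rfl
  | succ k ih =>
    have h := ih (by omega)
    rw [Function.iterate_succ_apply']
    have := depth_of_child (child_par (x := F.par^[k] x) (by omega))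
    omega

/-- The bound `k ≤ depth x` matters because `par` fixes the root: without it the root would count as
its own proper ancestor. -/
theorem transGen_iff {y x : F.Node} :
    Relation.TransGen F.child y x ↔ ∃ k, 0 < k ∧ k ≤ depth x ∧ F.par^[k] x = y := by
  constructor
  · intro h
    induction h with
    | single h =>
      exact ⟨1, one_pos, by rw [depth_of_child h]; omega, par_eq h⟩
    | tail _ h ih =>
      obtain ⟨k, _, hk, rfl⟩ := ih
      exact ⟨k + 1, by omega, by rw [depth_of_child h]; omega,
        by rw [Function.iterate_succ_apply, par_eq h]⟩
  · rintro ⟨k, h0, hk, rfl⟩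
    induction k with
    | zero => omega
    | succ k ih =>
      have hc : F.child (F.par^[k + 1] x) (F.par^[k] x) := by
        rw [Function.iterate_succ_apply']
        exact child_par (by rw [depth_par_iterate x (by omega)]; omega)
      rcases Nat.eq_zero_or_pos k with rfl | hk0
      · exact .single hc
      · exact .head hc (ih hk0 (by omega))

end FiniteTree

/-! ### Columns, and vertical adjacency by parity -/

namespace TilingGame

open FiniteTree

variable {G : TilingGame} {M : LabelledTree G.Symbol} {τ : M.Node → Tile G.Color}

theorem nr_eq_depth_mod (h1 : ∀ x, (¬ ∃ y, M.child y x) → nr M x = 0)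
    (h2 : ∀ x, nr M x ≠ 2 ^ G.n - 1 →
      (∃ y, M.child x y) ∧ ∀ y, M.child x y → nr M y = nr M x + 1)
    (h3 : ∀ x, nr M x = 2 ^ G.n - 1 → ∀ y, M.child x y → nr M y = 0) (x : M.Node) :
    nr M x = depth x % 2 ^ G.n := by
  have hpos : 0 < 2 ^ G.n := by positivity
  induction M.reachable x with
  | refl =>
    rw [depth_root, Nat.zero_mod]
    exact h1 _ fun ⟨y, hy⟩ => M.root_no_parent y hy
  | @tail b c _ hc ih =>
    rw [depth_of_child hc, Nat.add_mod, ← ih]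
    by_cases hb : nr M b = 2 ^ G.n - 1
    · rw [h3 b hb c hc, hb]
      -- For `n = 0` there is a single column and `1 % 2 ^ n` is `0` instead of `1`.
      rcases Nat.eq_or_lt_of_le (Nat.one_le_iff_ne_zero.2 hpos.ne') with h | h
      · simp [← h]
      · rw [Nat.mod_eq_of_lt h, Nat.sub_add_cancel hpos, Nat.mod_self]
    · rw [(h2 b hb).2 c hc]
      have := nr_lt M b
      rw [Nat.mod_eq_of_lt (a := 1) (by omega), Nat.mod_eq_of_lt (by omega)]

section Columns

variable (hnr : ∀ x : M.Node, nr M x = depth x % 2 ^ G.n)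
include hnr

theorem exists_ancestor_iff (x : M.Node) :
    (∃ y, Relation.TransGen M.child y x ∧ nr M x = nr M y) ↔ 2 ^ G.n ≤ depth x := by
  constructor
  · rintro ⟨y, hy, h⟩
    obtain ⟨k, h0, hk, rfl⟩ := transGen_iff.1 hy
    rw [hnr, hnr, depth_par_iterate x hk] at h
    by_contra hlt
    rw [Nat.mod_eq_of_lt (by omega), Nat.mod_eq_of_lt (by omega)] at h
    omega
  · intro h
    refine ⟨M.par^[2 ^ G.n] x, transGen_iff.2 ⟨_, by positivity, h, rfl⟩, ?_⟩
    rw [hnr, hnr, depth_par_iterate x h, Nat.mod_eq_sub_mod h]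

/-- Distances between nodes of one column on a branch are multiples of `2 ^ n`. This is the
recursion along a column on which the parity count rests. -/
theorem ancestor_iff {x b : M.Node} (h : 2 ^ G.n ≤ depth x) :
    Relation.TransGen M.child b x ∧ nr M b = nr M x ↔ b = M.par^[2 ^ G.n] x ∨
      Relation.TransGen M.child b (M.par^[2 ^ G.n] x) ∧ nr M b = nr M (M.par^[2 ^ G.n] x) := by
  have hx : nr M (M.par^[2 ^ G.n] x) = nr M x := by
    rw [hnr, hnr, depth_par_iterate x h, ← Nat.mod_eq_sub_mod h]
  have hpos : 0 < 2 ^ G.n := by positivity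
  rw [hx, transGen_iff, transGen_iff, depth_par_iterate x h]
  constructor
  · rintro ⟨⟨k, h0, hk, rfl⟩, hb⟩
    rcases lt_trichotomy k (2 ^ G.n) with hlt | rfl | hlt
    · rw [hnr, hnr, depth_par_iterate x hk] at hb
      have h1 : (depth x - k + k) % 2 ^ G.n = (depth x - k + 0) % 2 ^ G.n := by
        rw [Nat.sub_add_cancel hk, add_zero, hb]
      have h2 := (Nat.ModEq.add_left_cancel' _ h1 : k ≡ 0 [MOD 2 ^ G.n])
      rw [Nat.ModEq, Nat.mod_eq_of_lt hlt, Nat.zero_mod] at h2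
      omega
    · exact .inl rfl
    · refine .inr ⟨⟨k - 2 ^ G.n, by omega, by omega, ?_⟩, hb⟩
      rw [← Function.iterate_add_apply, Nat.sub_add_cancel hlt.le]
  · rintro (rfl | ⟨⟨k, h0, hk, rfl⟩, hb⟩)
    · exact ⟨⟨_, hpos, h, rfl⟩, hx⟩
    · exact ⟨⟨k + 2 ^ G.n, by omega, by omega, by rw [Function.iterate_add_apply]⟩, hb⟩

theorem oddAncestors_eq_empty {x : M.Node} (h : depth x < 2 ^ G.n) (i i' : Fin 4) (c : G.Color) :
    oddAncestors τ i i' c x = ∅ := by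
  rw [Set.eq_empty_iff_forall_notMem]
  rintro y ⟨hy, h', -⟩
  exact absurd ((exists_ancestor_iff hnr x).1 ⟨y, hy, h'.symm⟩) (by omega)

open Classical in
theorem ncard_oddAncestors {x : M.Node} (h : 2 ^ G.n ≤ depth x) (i i' : Fin 4) (c : G.Color) :
    (oddAncestors τ i i' c x).ncard = (oddAncestors τ i i' c (M.par^[2 ^ G.n] x)).ncard +
      if (τ (M.par^[2 ^ G.n] x) i = c ↔ τ (M.par^[2 ^ G.n] x) i' = c) then 0 else 1 := by
  have := M.finite
  set y := M.par^[2 ^ G.n] x with hy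
  have key : ∀ b, b ∈ oddAncestors τ i i' c x ↔
      (b = y ∧ ¬ (τ y i = c ↔ τ y i' = c)) ∨ b ∈ oddAncestors τ i i' c y := by
    intro b
    simp only [oddAncestors, Set.mem_ofPred_eq]
    rw [← and_assoc, ancestor_iff hnr h, ← hy, or_and_right, and_assoc]
    refine or_congr (and_congr_right ?_) Iff.rfl
    rintro rfl
    rfl
  split_ifs with hif
  · congr 1
    ext b
    simp [key, hif]
  · have : oddAncestors τ i i' c x = insert y (oddAncestors τ i i' c y) := by
      ext b
      simp [key, hif]
    rw [this, Set.ncard_insert_of_notMem]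
    rintro ⟨hy, -⟩
    obtain ⟨k, h0, hk, h'⟩ := transGen_iff.1 hy
    have := depth_par_iterate y hk
    rw [h'] at this
    omega

open Classical in
-- A telescoping sum: passing the node `y` above `x` changes the parity exactly when one of its two
-- edges, but not both, has colour `c`, and matching identifies the lower edge of `y` with the upper
-- edge of `x`. Matching is assumed only down to depth `d`, so that the count can be used while
-- matching is still being proved.
theorem ncard_oddAncestors_mod_two {i i' : Fin 4}
    (hfirst : ∀ x : M.Node, depth x < 2 ^ G.n → τ x i = G.white) {d : ℕ}
    (hadj : ∀ x : M.Node, depth x ≤ d → 2 ^ G.n ≤ depth x → τ (M.par^[2 ^ G.n] x) i' = τ x i)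
    (x : M.Node) (hd : depth x ≤ d) (c : G.Color) :
    (oddAncestors τ i i' c x).ncard % 2 =
      ((if c = G.white then 1 else 0) + if c = τ x i then 1 else 0) % 2 := by
  induction hx : depth x using Nat.strong_induction_on generalizing x with
  | _ e ih =>
    rcases lt_or_ge (depth x) (2 ^ G.n) with h | h
    · rw [oddAncestors_eq_empty hnr h, hfirst x h]
      split_ifs <;> simp
    · have hp : 0 < 2 ^ G.n := by positivity
      have hdy := depth_par_iterate x h
      have := ih _ (by omega) (M.par^[2 ^ G.n] x) (by omega) rfl
      rw [ncard_oddAncestors hnr h, Nat.add_mod, this, ← hadj x hd h]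
      grind

/-- For the forward direction let `y` be the node above `x`. By induction the column matches down to
`y`, which fixes the parity at `y` for the colour `c = τ x i`. Adding the contribution of `y` gives
[`c` is white] + [`τ y i'` is `c`], and the prescribed value forces `τ y i' = c`. -/
theorem parity_iff_vertical {i i' : Fin 4}
    (hfirst : ∀ x : M.Node, depth x < 2 ^ G.n → τ x i = G.white) :
    (∀ x, (oddAncestors τ i i' (τ x i) x).ncard % 2 = if τ x i = G.white then 0 else 1) ↔
      ∀ x : M.Node, 2 ^ G.n ≤ depth x → τ (M.par^[2 ^ G.n] x) i' = τ x i := by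
  have hp : 0 < 2 ^ G.n := by positivity
  constructor
  · intro hpar x
    induction hx : depth x using Nat.strong_induction_on generalizing x with
    | _ e ih =>
      intro h
      subst hx
      have hdy := depth_par_iterate x h
      have h1 := ncard_oddAncestors_mod_two (τ := τ) (i := i) (i' := i') hnr hfirst
        (d := depth (M.par^[2 ^ G.n] x)) (fun z hz => ih _ (by omega) z rfl) (M.par^[2 ^ G.n] x)
        le_rfl (τ x i)
      have h2 := hpar x
      rw [ncard_oddAncestors hnr h, Nat.add_mod, h1] at h2
      grind
  · intro hadj x
    rw [ncard_oddAncestors_mod_two hnr hfirst (d := depth x) (fun z _ => hadj z) x le_rfl]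
    grind

end Columns

end TilingGame

/-! ### Winning within a bounded number of moves -/

namespace TilingGame

variable {G : TilingGame}

theorem Follows.play {σ : List G.Row → G.Row} {ρ : List G.Row} (h : G.Follows σ ρ) : G.Play ρ := by
  induction h with
  | start => exact .start
  | prover _ hc _ hm ih => exact .move ih hc hm
  | spoiler _ hc _ hm ih => exact .move ih hc hm

theorem Play.head?_eq {ρ : List G.Row} (h : G.Play ρ) : ρ.head? = some G.initRow := by
  induction h with
  | start => rfl
  | move _ _ _ ih => simp [List.head?_append, ih]

theorem Follows.append_inv {σ : List G.Row → G.Row} {ρ : List G.Row} {r : G.Row} (hρ : ρ ≠ [])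
    (h : G.Follows σ (ρ ++ [r])) : G.Follows σ ρ ∧ ¬ G.Corridor ρ ∧ G.Move ρ r ∧
      (G.ProverTurn ρ → r = σ ρ) := by
  generalize hl : ρ ++ [r] = l at h
  cases h with
  | start =>
    have := congrArg List.length hl
    simp at this
    exact absurd this hρ
  | prover hf hc ht hm =>
    obtain ⟨rfl, h'⟩ := List.append_inj' hl rfl
    simp only [List.cons.injEq, and_true] at h'
    subst h'
    exact ⟨hf, hc, hm, fun _ => rfl⟩
  | spoiler hf hc ht hm =>
    obtain ⟨rfl, h'⟩ := List.append_inj' hl rfl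
    simp only [List.cons.injEq, and_true] at h'
    subst h'
    exact ⟨hf, hc, hm, fun h => absurd h ht⟩

open Classical in
/-- Prover can force a correctly tiled corridor within the given number of moves. -/
def WinIn (G : TilingGame) : ℕ → List G.Row → Prop
  | 0, ρ => G.Corridor ρ
  | k + 1, ρ => G.Corridor ρ ∨
      if G.ProverTurn ρ then ∃ r, G.Move ρ r ∧ WinIn G k (ρ ++ [r])
      else ∀ r, G.Move ρ r → WinIn G k (ρ ++ [r])

theorem WinIn.of_corridor {k : ℕ} {ρ : List G.Row} (h : G.Corridor ρ) : G.WinIn k ρ := by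
  cases k with
  | zero => exact h
  | succ k => exact .inl h

theorem WinIn.succ {k : ℕ} {ρ : List G.Row} (h : G.WinIn k ρ) : G.WinIn (k + 1) ρ := by
  induction k generalizing ρ with
  | zero => exact .of_corridor h
  | succ k ih =>
    rw [WinIn] at h ⊢
    refine h.imp_right fun h => ?_
    split_ifs at h ⊢
    · obtain ⟨r, hr, h⟩ := h
      exact ⟨r, hr, ih h⟩
    · exact fun r hr => ih (h r hr)

theorem WinIn.mono {k l : ℕ} {ρ : List G.Row} (h : G.WinIn k ρ) (hkl : k ≤ l) : G.WinIn l ρ := by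
  induction hkl with
  | refl => exact h
  | step _ ih => exact ih.succ

open Classical in
/-- The strategy that moves to a position from which the win is as near as possible. -/
noncomputable def nearestWin (G : TilingGame) (ρ : List G.Row) : G.Row :=
  if h : ∃ k, ∃ r, G.Move ρ r ∧ G.WinIn k (ρ ++ [r]) then (Nat.find_spec h).choose
  else G.initRow

/-- By minimality and monotonicity one row serves every bound `k` that some row serves, so the
strategy need not know the bound. -/
theorem nearestWin_spec {ρ : List G.Row} {k : ℕ} {r : G.Row} (hr : G.Move ρ r)
    (h : G.WinIn k (ρ ++ [r])) :
    G.Move ρ (G.nearestWin ρ) ∧ G.WinIn k (ρ ++ [G.nearestWin ρ]) := by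
  classical
  have h' : ∃ k, ∃ r, G.Move ρ r ∧ G.WinIn k (ρ ++ [r]) := ⟨k, r, hr, h⟩
  have hs := (Nat.find_spec h').choose_spec
  rw [nearestWin, dif_pos h']
  exact ⟨hs.1, hs.2.mono (Nat.find_min' h' ⟨r, hr, h⟩)⟩

theorem WinIn.step {ρ : List G.Row} {r : G.Row} {k : ℕ} (hρ : ρ ≠ []) (h : G.WinIn (k + 1) ρ)
    (hf : G.Follows G.nearestWin (ρ ++ [r])) : G.WinIn k (ρ ++ [r]) := by
  obtain ⟨-, hc, hm, ht⟩ := hf.append_inv hρ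
  rw [WinIn] at h
  have h := h.resolve_left hc
  split_ifs at h with hturn
  · obtain ⟨r', hr', h'⟩ := h
    rw [ht hturn]
    exact (nearestWin_spec hr' h').2
  · exact h r hm

/-- Along a play following `nearestWin` the bound drops with every move, whoever makes it. Prover is
never stuck because of `WinIn`, Spoiler because of well-formedness. -/
theorem proverWins_of_winIn (hwf : G.WellFormed) {k : ℕ} (h : G.WinIn k [G.initRow]) :
    G.ProverWins := by
  have hwin : ∀ ρ, G.Follows G.nearestWin ρ → ρ ≠ [] ∧ ∃ k, G.WinIn k ρ := by
    intro ρ hf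
    have hstep : ∀ {ρ r}, (ρ ≠ [] ∧ ∃ k, G.WinIn k ρ) → ¬ G.Corridor ρ →
        G.Follows G.nearestWin (ρ ++ [r]) → ρ ++ [r] ≠ [] ∧ ∃ k, G.WinIn k (ρ ++ [r]) := by
      rintro ρ r ⟨hρ, k, hk⟩ hc hf
      cases k with
      | zero => exact absurd hk hc
      | succ k => exact ⟨by simp, k, hk.step hρ hf⟩
    induction hf with
    | start => exact ⟨by simp, k, h⟩
    | prover hf hc ht hm ih => exact hstep ih hc (.prover hf hc ht hm)
    | spoiler hf hc ht hm ih => exact hstep ih hc (.spoiler hf hc ht hm)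
  refine ⟨G.nearestWin, fun ρ hf hc => ?_, ?_⟩
  · by_cases ht : G.ProverTurn ρ
    · obtain ⟨-, k, hk⟩ := hwin ρ hf
      cases k with
      | zero => exact absurd hk hc
      | succ k =>
        rw [WinIn, if_pos ht] at hk
        obtain ⟨r, hr, hk⟩ := hk.resolve_left hc
        exact ⟨_, .prover hf hc ht (nearestWin_spec hr hk).1⟩
    · obtain ⟨r, hr, -⟩ := hwf ρ hf.play hc 0
      exact ⟨r, .spoiler hf hc ht ⟨0, hr⟩⟩
  · rintro ⟨π, hπ⟩
    have hsucc : ∀ m, (List.range (m + 1 + 1)).map π =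
        (List.range (m + 1)).map π ++ [π (m + 1)] := fun m => by
      rw [List.range_succ, List.map_append, List.map_singleton]
    have hne : ∀ m, (List.range (m + 1)).map π ≠ [] := by simp
    -- A corridor ends the play, so an infinite play never contains one.
    have hnot : ∀ m, ¬ G.Corridor ((List.range (m + 1)).map π) := fun m =>
      ((hsucc m ▸ hπ (m + 1)).append_inv (hne m)).2.1
    have h0 : (List.range 1).map π = [G.initRow] := by
      simpa using (hπ 0).play.head?_eq
    -- After `m` moves a win within `k - m` moves is left; `m = k` yields a corridor.
    have key : ∀ m, ∀ l, m + l = k → G.WinIn l ((List.range (m + 1)).map π) := by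
      intro m
      induction m with
      | zero =>
        intro l hl
        rw [h0]
        exact (by omega : l = k) ▸ h
      | succ m ih =>
        intro l hl
        have := hπ (m + 1)
        rw [hsucc] at this ⊢
        exact (ih (l + 1) (by omega)).step (hne m) this
    exact hnot k (key k 0 rfl)

end TilingGame

/-! ### The formula as a list of conditions on the tree -/

namespace TilingGame

open FiniteTree

variable {G : TilingGame}

/-- The conditions expressed by the formula of the game, for a tree whose node `x` carries the tile
`τ x`. The rows of the tree are the blocks of `2 ^ n` consecutive levels. -/
structure IsModel (M : LabelledTree G.Symbol) (τ : M.Node → Tile G.Color) : Prop where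
  nr_eq : ∀ x : M.Node, nr M x = depth x % 2 ^ G.n
  exists_child : ∀ x, nr M x ≠ 2 ^ G.n - 1 → ∃ y, M.child x y
  color : ∀ x i c, M.label (.color i c) x ↔ τ x i = c
  tile_mem : ∀ x, τ x ∈ G.tiles
  tile : ∀ x, ∀ t ∈ G.tiles, M.label (.tile t) x ↔ τ x = t
  setT : ∀ x i, M.label (.setT i) x ↔ τ x ∈ G.T i
  setL : ∀ x, M.label .setL x ↔ τ x ∈ G.L
  first : ∀ x, M.label .first x ↔ depth x < 2 ^ G.n
  last : ∀ x, M.label .last x ↔ ¬ ∃ y, Relation.TransGen M.child x y ∧ nr M x = nr M y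
  first_tile : ∀ x : M.Node, depth x < 2 ^ G.n → τ x = G.initRow ⟨nr M x, nr_lt M x⟩
  first_white : ∀ x : M.Node, depth x < 2 ^ G.n → τ x 0 = G.white ∧ τ x 1 = G.white
  last_tile : ∀ x, M.label .last x → τ x 2 = G.white ∧ τ x 3 = G.white ∧ τ x ∈ G.L
  exi_iff : ∀ x, M.label .exi x ↔ ¬ M.label .uni x
  exi_par : ∀ x, nr M x ≠ 0 → (M.label .exi (M.par x) ↔ M.label .exi x)
  exi_first : ∀ x : M.Node, depth x < 2 ^ G.n → M.label .exi x
  exi_par_row : ∀ x : M.Node, nr M x = 0 → 2 ^ G.n ≤ depth x →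
    (M.label .exi (M.par x) ↔ M.label .uni x)
  move_iff : ∀ x : M.Node, 2 ^ G.n ≤ depth x → (M.label (.move 0) x ↔ ¬ M.label (.move 1) x)
  move_par : ∀ x, nr M x ≠ 0 → (M.label (.move 0) (M.par x) ↔ M.label (.move 0) x)
  move_mem : ∀ i x, M.label (.move i) x → τ x ∈ G.T i
  uni_branch : ∀ x, nr M x = 2 ^ G.n - 1 → ¬ M.label .last x → M.label .uni x →
    ∀ i, ∃ y, M.child x y ∧ M.label (.move i) y
  left_white : ∀ x, nr M x = 0 → τ x 0 = G.white ∧ τ x 2 = G.white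
  right_white : ∀ x, nr M x = 2 ^ G.n - 1 → τ x 1 = G.white ∧ τ x 3 = G.white
  hAdj : ∀ x, nr M x ≠ 0 → (τ (M.par x)).HAdj (τ x)
  vAdj : ∀ x : M.Node, 2 ^ G.n ≤ depth x → (τ (M.par^[2 ^ G.n] x)).VAdj (τ x)

variable {M : LabelledTree G.Symbol} {s : Var → M.Node}

theorem sat_numbering_iff_depth : G.numbering.Sat M s ↔
    (∀ x : M.Node, nr M x = depth x % 2 ^ G.n) ∧
      ∀ x, nr M x ≠ 2 ^ G.n - 1 → ∃ y, M.child x y := by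
  rw [sat_numbering]
  constructor
  · rintro ⟨h1, h2, h3⟩
    exact ⟨nr_eq_depth_mod h1 h2 h3, fun x hx => (h2 x hx).1⟩
  · rintro ⟨h1, h2⟩
    refine ⟨fun x hx => ?_, fun x hx => ⟨h2 x hx, fun y hy => ?_⟩, fun x hx y hy => ?_⟩
    · rw [exists_child_iff, not_not] at hx
      rw [h1, hx, Nat.zero_mod]
    · have hlt := nr_lt M x
      rw [h1] at hx hlt
      rw [h1, h1, depth_of_child hy, Nat.add_mod, Nat.mod_eq_of_lt (a := 1) (by omega),
        Nat.mod_eq_of_lt (by omega)]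
    · have hpos : 0 < 2 ^ G.n := by positivity
      rw [h1] at hx
      rw [h1, depth_of_child hy, ← Nat.mod_add_mod, hx, Nat.sub_add_cancel hpos, Nat.mod_self]

/-- Parents are unique, so the formula can speak of the parent through an existential quantifier. -/
theorem exists_child_and_iff {x : M.Node} (h : depth x ≠ 0) {P : M.Node → Prop} :
    (∃ y, M.child y x ∧ P y) ↔ P (M.par x) := by
  constructor
  · rintro ⟨y, hy, h'⟩
    rwa [par_eq hy]
  · intro h'
    exact ⟨_, child_par h, h'⟩

theorem sat_formula : G.formula.Sat M s ↔ ∃ τ, IsModel M τ := by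
  simp only [formula, Formula.sat_conj, List.mem_cons, List.not_mem_nil, or_false,
    forall_eq_or_imp, forall_eq]
  constructor
  · rintro ⟨h1, h2, h3, h4, h5, h6, h7⟩
    rw [sat_numbering_iff_depth] at h1
    rw [sat_tilesAndColors] at h2
    obtain ⟨hnr, hch⟩ := h1
    obtain ⟨τ, hc, hm, ht, hT, hL⟩ := h2
    rw [sat_firstAndLastRow hc ht] at h3
    rw [sat_existentialAndUniversalRows] at h4
    rw [sat_universalRowsHaveTwoSuccessors] at h5
    rw [sat_horizontalAdjacency hc] at h6
    rw [sat_verticalAdjacency hc] at h7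
    obtain ⟨f1, f2, f3, f4, f5, f6⟩ := h3
    obtain ⟨e1, e2, e3, e4⟩ := h4
    obtain ⟨m1, m2, m3, m4, m5⟩ := h5
    obtain ⟨a1, a2, a3, a4⟩ := h6
    have hd : ∀ x : M.Node, nr M x ≠ 0 → depth x ≠ 0 := by
      intro x h h'
      rw [hnr, h', Nat.zero_mod] at h
      exact h rfl
    have hfirst : ∀ x, M.label .first x ↔ depth x < 2 ^ G.n := by
      intro x
      rw [f1, exists_ancestor_iff hnr, not_le]
    have hpos : 0 < 2 ^ G.n := by positivity
    have hwhite : ∀ x : M.Node, depth x < 2 ^ G.n → τ x 0 = G.white ∧ τ x 1 = G.white :=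
      fun x h => f5 x ((hfirst x).2 h)
    -- The white upper edge of the first row is the starting point of the parity count.
    rw [parity_iff_vertical hnr fun x h => (hwhite x h).1,
      parity_iff_vertical hnr fun x h => (hwhite x h).2] at h7
    exact ⟨τ, {
      nr_eq := hnr
      exists_child := hch
      color := hc
      tile_mem := hm
      tile := ht
      setT := hT
      setL := hL
      first := hfirst
      last := f2
      first_tile := by
        intro x h
        rw [← hfirst] at h
        unfold initRow
        split_ifs with h'
        · exact f3 x ⟨nr M x, h'⟩ h rfl
        · exact f4 x h (by simp only at h'; omega)
      first_white := hwhite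
      last_tile := fun x h => ⟨(f6 x h).1.1, (f6 x h).1.2, (hL x).1 (f6 x h).2⟩
      exi_iff := e1
      exi_par := fun x h => (exists_child_and_iff (hd x h)).1 (e2 x h)
      exi_first := fun x h => e3 x ((hfirst x).2 h)
      exi_par_row := fun x h h' =>
        (exists_child_and_iff (by omega)).1 (e4 x h (by rw [hfirst]; omega))
      move_iff := fun x h => m1 x (by rw [hfirst]; omega)
      move_par := fun x h => (exists_child_and_iff (hd x h)).1 (m2 x h)
      move_mem := by
        intro i x
        rw [← hT]
        fin_cases i
        exacts [m3 x, m4 x]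
      uni_branch := by
        intro x h h' h'' i
        fin_cases i
        exacts [(m5 x h h' h'').1, (m5 x h h' h'').2]
      left_white := a1
      right_white := a2
      hAdj := fun x h => ⟨(exists_child_and_iff (hd x h)).1 (a3 x h),
        (exists_child_and_iff (hd x h)).1 (a4 x h)⟩
      vAdj := fun x h => ⟨h7.1 x h, h7.2 x h⟩ }⟩
  · rintro ⟨τ, h⟩
    have hd : ∀ x : M.Node, nr M x ≠ 0 → depth x ≠ 0 := by
      intro x hx h'
      rw [h.nr_eq, h', Nat.zero_mod] at hx
      exact hx rfl
    have hpos : 0 < 2 ^ G.n := by positivity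
    refine ⟨sat_numbering_iff_depth.2 ⟨h.nr_eq, h.exists_child⟩,
      sat_tilesAndColors.2 ⟨τ, h.color, h.tile_mem, h.tile, h.setT, h.setL⟩,
      (sat_firstAndLastRow h.color h.tile).2 ⟨fun x => ?_, h.last, fun x i hx hi => ?_,
        fun x hx hi => ?_, fun x hx => h.first_white x ((h.first x).1 hx), fun x hx => ?_⟩,
      sat_existentialAndUniversalRows.2 ⟨h.exi_iff, fun x hx => ?_,
        fun x hx => h.exi_first x ((h.first x).1 hx), fun x hx hx' => ?_⟩,
      sat_universalRowsHaveTwoSuccessors.2 ⟨fun x hx => ?_, fun x hx => ?_, fun x hx => ?_,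
        fun x hx => ?_,
        fun x h1 h2 h3 => ⟨h.uni_branch x h1 h2 h3 0, h.uni_branch x h1 h2 h3 1⟩⟩,
      (sat_horizontalAdjacency h.color).2 ⟨h.left_white, h.right_white, fun x hx => ?_,
        fun x hx => ?_⟩,
      (sat_verticalAdjacency h.color).2 ⟨?_, ?_⟩⟩
    · rw [exists_ancestor_iff h.nr_eq, not_le, h.first]
    · rw [h.first_tile x ((h.first x).1 hx), initRow, dif_pos (by simp only [hi]; exact i.2)]
      congr
    · rw [h.first_tile x ((h.first x).1 hx), initRow, dif_neg (by simp only; omega)]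
    · obtain ⟨h2, h3, h4⟩ := h.last_tile x hx
      exact ⟨⟨h2, h3⟩, (h.setL x).2 h4⟩
    · exact (exists_child_and_iff (hd x hx)).2 (h.exi_par x hx)
    · rw [h.first, not_lt] at hx'
      exact (exists_child_and_iff (by omega)).2 (h.exi_par_row x hx hx')
    · rw [h.first, not_lt] at hx
      exact h.move_iff x hx
    · exact (exists_child_and_iff (hd x hx)).2 (h.move_par x hx)
    · exact (h.setT x 0).2 (h.move_mem 0 x hx)
    · exact (h.setT x 1).2 (h.move_mem 1 x hx)
    · exact (exists_child_and_iff (hd x hx)).2 (h.hAdj x hx).1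
    · exact (exists_child_and_iff (hd x hx)).2 (h.hAdj x hx).2
    · rw [parity_iff_vertical h.nr_eq fun x hx => (h.first_white x hx).1]
      exact fun x hx => (h.vAdj x hx).1
    · rw [parity_iff_vertical h.nr_eq fun x hx => (h.first_white x hx).2]
      exact fun x hx => (h.vAdj x hx).2

end TilingGame

/-! ### From a model to a winning strategy -/

namespace TilingGame

open FiniteTree

variable {G : TilingGame} {M : LabelledTree G.Symbol} {τ : M.Node → Tile G.Color}

/-- The row of the tiling that ends at the node `z` of the last column. -/
noncomputable def rowAt (M : LabelledTree G.Symbol) (τ : M.Node → Tile G.Color) (z : M.Node) :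
    G.Row :=
  fun j => τ (M.par^[2 ^ G.n - 1 - j] z)

/-- The last `m + 1` rows above the node `z` of the last column. -/
noncomputable def rowsAt (M : LabelledTree G.Symbol) (τ : M.Node → Tile G.Color) :
    ℕ → M.Node → List G.Row
  | 0, z => [rowAt M τ z]
  | m + 1, z => rowsAt M τ m (M.par^[2 ^ G.n] z) ++ [rowAt M τ z]

theorem length_rowsAt (m : ℕ) (z : M.Node) : (rowsAt M τ m z).length = m + 1 := by
  induction m generalizing z with
  | zero => rfl
  | succ m ih => rw [rowsAt, List.length_append, ih, List.length_singleton]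

theorem getLast?_rowsAt (m : ℕ) (z : M.Node) :
    (rowsAt M τ m z).getLast? = some (rowAt M τ z) := by
  cases m with
  | zero => rfl
  | succ m => rw [rowsAt, List.getLast?_concat]

theorem PartialTiling.append {ρ : List G.Row} {r r' : G.Row} (h : G.PartialTiling ρ)
    (hr : ρ.getLast? = some r) (hc : G.RowCorrect r') (hv : ∀ j, (r j).VAdj (r' j)) :
    G.PartialTiling (ρ ++ [r']) := by
  obtain ⟨h1, h2, h3, h4⟩ := h
  refine ⟨by simp [List.head?_append, h1], h2, fun r'' h' => ?_, ?_⟩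
  · simp only [List.mem_append, List.mem_singleton] at h'
    rcases h' with h' | rfl
    exacts [h3 _ h', hc]
  · rw [List.isChain_append]
    refine ⟨h4, List.isChain_singleton _, fun x hx y hy => ?_⟩
    simp only [hr, Option.mem_def, Option.some.injEq, List.head?_cons] at hx hy
    subst hx hy
    exact hv

namespace IsModel

variable (h : IsModel M τ)
include h

/-- The shape of `depth z` says that `z` closes the block `m`, counted from `0`; going up `2 ^ n - 1
- j` levels stays in the block. -/
theorem nr_par_iterate {m : ℕ} {z : M.Node} (hz : depth z = m * 2 ^ G.n + (2 ^ G.n - 1))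
    {j : ℕ} (hj : j < 2 ^ G.n) : nr M (M.par^[2 ^ G.n - 1 - j] z) = j := by
  rw [h.nr_eq, depth_par_iterate z (by omega), hz,
    show m * 2 ^ G.n + (2 ^ G.n - 1) - (2 ^ G.n - 1 - j) = j + 2 ^ G.n * m by
      rw [Nat.mul_comm]; omega, Nat.add_mul_mod_self_left, Nat.mod_eq_of_lt hj]

theorem nr_last {m : ℕ} {z : M.Node} (hz : depth z = m * 2 ^ G.n + (2 ^ G.n - 1)) :
    nr M z = 2 ^ G.n - 1 := by
  have hpos : 0 < 2 ^ G.n := by positivity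
  simpa using h.nr_par_iterate hz (j := 2 ^ G.n - 1) (by omega)

theorem rowCorrect {m : ℕ} {z : M.Node} (hz : depth z = m * 2 ^ G.n + (2 ^ G.n - 1)) :
    G.RowCorrect (rowAt M τ z) := by
  refine ⟨fun j j' hj => ?_, fun j hj => ?_, fun j hj => ?_⟩
  · have := h.hAdj _ (by rw [h.nr_par_iterate hz j'.2]; omega)
    rw [← Function.iterate_succ_apply' M.par] at this
    have he : (2 ^ G.n - 1 - (j' : ℕ)).succ = 2 ^ G.n - 1 - j := by omega
    rwa [he] at this
  · exact h.left_white _ (by rw [h.nr_par_iterate hz j.2, hj])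
  · exact h.right_white _ (by rw [h.nr_par_iterate hz j.2]; omega)

theorem rowAt_eq_initRow {z : M.Node} (hz : depth z = 2 ^ G.n - 1) :
    rowAt M τ z = G.initRow := by
  have hpos : 0 < 2 ^ G.n := by positivity
  funext j
  have hz' : depth z = 0 * 2 ^ G.n + (2 ^ G.n - 1) := by omega
  rw [rowAt, h.first_tile _ (by rw [depth_par_iterate z (by omega)]; omega)]
  congr
  exact h.nr_par_iterate hz' j.2

theorem partialTiling {m : ℕ} {z : M.Node} (hz : depth z = m * 2 ^ G.n + (2 ^ G.n - 1)) :
    G.PartialTiling (rowsAt M τ m z) := by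
  have hpos : 0 < 2 ^ G.n := by positivity
  induction m generalizing z with
  | zero =>
    have hr := h.rowAt_eq_initRow (by omega : depth z = 2 ^ G.n - 1)
    refine ⟨by simp [rowsAt, hr], fun j => ?_, fun r hr' => ?_, List.isChain_singleton _⟩
    · rw [← hr]
      exact h.first_white _ (by rw [depth_par_iterate z (by omega)]; omega)
    · rw [rowsAt, List.mem_singleton] at hr'
      rw [hr']
      exact h.rowCorrect hz
  | succ m ih =>
    have hs : (m + 1) * 2 ^ G.n = m * 2 ^ G.n + 2 ^ G.n := Nat.succ_mul m (2 ^ G.n)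
    refine (ih (z := M.par^[2 ^ G.n] z) (by rw [depth_par_iterate z (by omega)]; omega)).append
      (getLast?_rowsAt _ _) (h.rowCorrect hz) fun j => ?_
    have := h.vAdj (M.par^[2 ^ G.n - 1 - j] z) (by rw [depth_par_iterate z (by omega)]; omega)
    rwa [← Function.iterate_add_apply, add_comm, Function.iterate_add_apply] at this

/-- The kind is inherited inside a block and flips on entering column `0`. With `m + 1` rows
present, block `m` is existential exactly when it is Prover's turn. -/
theorem exi_iff_even (x : M.Node) : M.label .exi x ↔ Even (depth x / 2 ^ G.n) := by
  have hpos : 0 < 2 ^ G.n := by positivity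
  induction hx : depth x using Nat.strong_induction_on generalizing x with
  | _ d ih =>
    subst hx
    rcases lt_or_ge (depth x) (2 ^ G.n) with hlt | hge
    · simp [Nat.div_eq_of_lt hlt, h.exi_first x hlt]
    · have hp := depth_of_child (child_par (x := x) (by omega))
      have hpar : M.label .exi (M.par x) ↔ Even (depth (M.par x) / 2 ^ G.n) :=
        ih _ (by omega) (M.par x) rfl
      have hn := h.nr_eq x
      rw [hp, Nat.succ_div]
      split_ifs with hd
      · rw [← hp] at hd
        rw [Nat.mod_eq_zero_of_dvd hd] at hn
        rw [Nat.even_add_one, ← hpar, h.exi_par_row x hn hge, h.exi_iff x]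
      · rw [← hp, Nat.dvd_iff_mod_eq_zero] at hd
        rw [add_zero, ← hpar, h.exi_par x (by omega)]

/-- `move 0` is constant along the row. `move 1` inherits this as its complement, which is available
only below the first row; hence the depth starts at `m + 1`. -/
theorem mem_T {m : ℕ} {z : M.Node} (hz : depth z = (m + 1) * 2 ^ G.n + (2 ^ G.n - 1)) {i : Fin 2}
    (hi : M.label (.move i) (M.par^[2 ^ G.n - 1] z)) (j : Fin (2 ^ G.n)) :
    rowAt M τ z j ∈ G.T i := by
  have hpos : 0 < 2 ^ G.n := by positivity
  have hs : (m + 1) * 2 ^ G.n = m * 2 ^ G.n + 2 ^ G.n := Nat.succ_mul m (2 ^ G.n)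
  have h0 : ∀ k < 2 ^ G.n,
      (M.label (.move 0) (M.par^[k] z) ↔ M.label (.move 0) z) := by
    intro k hk
    induction k with
    | zero => rfl
    | succ k ih =>
      rw [Function.iterate_succ_apply', h.move_par, ih (by omega)]
      have := h.nr_par_iterate hz (j := 2 ^ G.n - 1 - k) (by omega)
      rw [show 2 ^ G.n - 1 - (2 ^ G.n - 1 - k) = k by omega] at this
      omega
  have h1 : ∀ k < 2 ^ G.n,
      (M.label (.move 1) (M.par^[k] z) ↔ ¬ M.label (.move 0) z) := by
    intro k hk
    rw [← h0 k hk, h.move_iff _ (by rw [depth_par_iterate z (by omega)]; omega), not_not]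
  apply h.move_mem
  fin_cases i
  · exact (h0 _ (by omega)).2 ((h0 _ (by omega)).1 hi)
  · exact (h1 _ (by omega)).2 ((h1 _ (by omega)).1 hi)

theorem exists_row_end (x : M.Node) {k : ℕ} (hk : nr M x + k = 2 ^ G.n - 1) :
    ∃ w, depth w = depth x + k ∧ M.par^[k] w = x := by
  induction k generalizing x with
  | zero => exact ⟨x, rfl, rfl⟩
  | succ k ih =>
    obtain ⟨y, hy⟩ := h.exists_child x (by omega)
    have hd := depth_of_child hy
    have hny : nr M y = nr M x + 1 := by
      rw [h.nr_eq] at hk ⊢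
      rw [h.nr_eq, hd, Nat.add_mod, Nat.mod_eq_of_lt (a := 1) (by omega),
        Nat.mod_eq_of_lt (by omega)]
    obtain ⟨w, hw, hw'⟩ := ih y (by omega)
    exact ⟨w, by omega, by rw [Function.iterate_succ_apply', hw', par_eq hy]⟩

theorem le_of_descendant {x y : M.Node} {k : ℕ} (h0 : 0 < k) (hk : k ≤ depth y)
    (hx : M.par^[k] y = x) (hn : nr M x = nr M y) : 2 ^ G.n ≤ k := by
  subst hx
  rw [h.nr_eq, h.nr_eq, depth_par_iterate y hk] at hn
  have h1 : depth y - k + 0 ≡ depth y - k + k [MOD 2 ^ G.n] := by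
    rw [Nat.sub_add_cancel hk]
    exact hn
  have h2 := (Nat.ModEq.add_left_cancel' _ h1).symm
  exact Nat.le_of_dvd h0 ((Nat.modEq_zero_iff_dvd).1 h2)

/-- A row that starts at `x` and goes on below unless `x` is in the last row. -/
theorem exists_complete_row {x : M.Node} (hx : nr M x = 0) :
    ∃ w, depth w = depth x + (2 ^ G.n - 1) ∧ M.par^[2 ^ G.n - 1] w = x ∧
      ((∃ y, M.child w y) ∨ M.label .last x) := by
  have hpos : 0 < 2 ^ G.n := by positivity
  by_cases hl : M.label .last x
  · obtain ⟨w, hw, hw'⟩ := h.exists_row_end x (k := 2 ^ G.n - 1) (by omega)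
    exact ⟨w, hw, hw', .inr hl⟩
  · rw [h.last, not_not] at hl
    obtain ⟨y, hy, hn⟩ := hl
    obtain ⟨k, h0, hk, rfl⟩ := transGen_iff.1 hy
    have hle := h.le_of_descendant h0 hk rfl hn
    -- The row end is chosen on the path from `x` to its descendant `y` in the same column, so the
    -- path itself supplies a child. Another row below `x` might end in a leaf.
    refine ⟨M.par^[k - 2 ^ G.n + 1] y, ?_, ?_, .inl ⟨M.par^[k - 2 ^ G.n] y, ?_⟩⟩
    · rw [depth_par_iterate y (by omega), depth_par_iterate y hk]
      omega
    · rw [← Function.iterate_add_apply]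
      congr 2
      omega
    · rw [Function.iterate_succ_apply']
      exact child_par (by rw [depth_par_iterate y (by omega)]; omega)

theorem last_of_last {m : ℕ} {z : M.Node} (hz : depth z = m * 2 ^ G.n + (2 ^ G.n - 1))
    (hl : M.label .last (M.par^[2 ^ G.n - 1] z)) {j : ℕ} (hj : j < 2 ^ G.n) :
    M.label .last (M.par^[j] z) := by
  rw [h.last] at hl ⊢
  rintro ⟨y, hy, hn⟩
  refine hl ?_
  obtain ⟨k, h0, hk, hku⟩ := transGen_iff.1 hy
  have hle := h.le_of_descendant h0 hk hku hn
  have hd := depth_par_iterate y hk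
  rw [hku, depth_par_iterate z (by omega)] at hd
  -- The witness is the node on the path to `y` at depth `depth z + 1`. It need not be a child of
  -- `z`, but it lies in column `0`, `2 ^ n` levels below the first node of the row.
  have hv : M.par^[2 ^ G.n] (M.par^[k - 1 - j] y) = M.par^[2 ^ G.n - 1] z := by
    rw [← Function.iterate_add_apply, show 2 ^ G.n - 1 = (2 ^ G.n - 1 - j) + j by omega,
      Function.iterate_add_apply (n := j), ← hku, ← Function.iterate_add_apply,
      show 2 ^ G.n + (k - 1 - j) = 2 ^ G.n - 1 - j + k by omega]
  refine ⟨M.par^[k - 1 - j] y, transGen_iff.2 ⟨2 ^ G.n, by positivity, ?_, hv⟩, ?_⟩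
  · rw [depth_par_iterate y (by omega)]
    omega
  · have hdv : 2 ^ G.n ≤ depth (M.par^[k - 1 - j] y) := by
      rw [depth_par_iterate y (by omega)]
      omega
    rw [← hv, h.nr_eq, h.nr_eq, depth_par_iterate _ hdv, ← Nat.mod_eq_sub_mod hdv]

theorem not_last_of_child {m : ℕ} {z y : M.Node} (hz : depth z = m * 2 ^ G.n + (2 ^ G.n - 1))
    (hy : M.child z y) : ¬ M.label .last z := by
  have hpos : 0 < 2 ^ G.n := by positivity
  have hs : (m + 1) * 2 ^ G.n = m * 2 ^ G.n + 2 ^ G.n := Nat.succ_mul m (2 ^ G.n)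
  have hd := depth_of_child hy
  have hd' : depth y = (m + 1) * 2 ^ G.n := by omega
  obtain ⟨w, hw, hw'⟩ := h.exists_row_end y (k := 2 ^ G.n - 1)
    (by rw [h.nr_eq, hd', Nat.mul_mod_left, zero_add])
  rw [h.last, not_not]
  refine ⟨w, transGen_iff.2 ⟨2 ^ G.n - 1 + 1, by omega, by omega, ?_⟩, ?_⟩
  · rw [Function.iterate_succ_apply', hw', par_eq hy]
  · rw [h.nr_last hz, h.nr_last (m := m + 1) (by omega)]

theorem corridor_of_last {m : ℕ} {z : M.Node} (hz : depth z = m * 2 ^ G.n + (2 ^ G.n - 1))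
    (hl : M.label .last (M.par^[2 ^ G.n - 1] z)) : G.Corridor (rowsAt M τ m z) := by
  refine ⟨h.partialTiling hz, fun r hr j => ?_⟩
  rw [getLast?_rowsAt, Option.some.injEq] at hr
  subst hr
  obtain ⟨h2, h3, h4⟩ := h.last_tile _ (h.last_of_last hz hl (j := 2 ^ G.n - 1 - j) (by omega))
  exact ⟨h4, h2, h3⟩

/-- Induction on the number `k` of moves left. The invariant `hl` says that the tree goes on below
`z` unless its row is a last one, in which case there is a corridor. A branch may also run on below
a corridor; the game has ended there. -/
theorem winIn_rowsAt (hwf : G.WellFormed) {D : ℕ} (hD : ∀ x : M.Node, depth x < D) {k m : ℕ}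
    {z : M.Node} (hk : D ≤ m + k) (hz : depth z = m * 2 ^ G.n + (2 ^ G.n - 1))
    (hp : G.Play (rowsAt M τ m z))
    (hl : (∃ y, M.child z y) ∨ M.label .last (M.par^[2 ^ G.n - 1] z)) :
    G.WinIn k (rowsAt M τ m z) := by
  have hpos : 0 < 2 ^ G.n := by positivity
  induction k generalizing m z with
  | zero =>
    -- Block `m` has depth at least `m`, so with no moves left `z` would be too deep.
    have := hD z
    have := Nat.le_mul_of_pos_right m hpos
    omega
  | succ k ih =>
    by_cases hc : G.Corridor (rowsAt M τ m z)
    · exact .of_corridor hc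
    have hs : (m + 1) * 2 ^ G.n = m * 2 ^ G.n + 2 ^ G.n := Nat.succ_mul m (2 ^ G.n)
    have step : ∀ y, M.child z y → ∀ i, M.label (.move i) y →
        ∃ r, G.CanBuild (rowsAt M τ m z) i r ∧ G.WinIn k (rowsAt M τ m z ++ [r]) := by
      intro y hy i hi
      have hd := depth_of_child hy
      have hd' : depth y = (m + 1) * 2 ^ G.n := by omega
      obtain ⟨w, hw, hw', hlw⟩ :=
        h.exists_complete_row (x := y) (by rw [h.nr_eq, hd', Nat.mul_mod_left])
      have hwz : M.par^[2 ^ G.n] w = z := by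
        rw [show 2 ^ G.n = 2 ^ G.n - 1 + 1 by omega, Function.iterate_succ_apply', hw', par_eq hy]
      have hdw : depth w = (m + 1) * 2 ^ G.n + (2 ^ G.n - 1) := by omega
      have hrows : rowsAt M τ (m + 1) w = rowsAt M τ m z ++ [rowAt M τ w] := by
        rw [rowsAt, hwz]
      have hb : G.CanBuild (rowsAt M τ m z) i (rowAt M τ w) :=
        ⟨h.mem_T hdw (hw'.symm ▸ hi), hrows ▸ h.partialTiling hdw⟩
      refine ⟨rowAt M τ w, hb, hrows ▸ ih (by omega) hdw ?_ (hw'.symm ▸ hlw)⟩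
      rw [hrows]
      exact .move hp hc ⟨i, hb⟩
    obtain ⟨y, hy⟩ := hl.resolve_right fun hl => hc (h.corridor_of_last hz hl)
    have hturn : G.ProverTurn (rowsAt M τ m z) ↔ M.label .exi z := by
      rw [ProverTurn, length_rowsAt, h.exi_iff_even, hz, Nat.odd_add_one, Nat.not_odd_iff_even,
        Nat.mul_comm, Nat.mul_add_div hpos, Nat.div_eq_of_lt (by omega : 2 ^ G.n - 1 < 2 ^ G.n),
        add_zero]
    rw [WinIn]
    right
    split_ifs with ht
    · have hm := h.move_iff y (by have := depth_of_child hy; omega)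
      by_cases h0 : M.label (.move 0) y
      · obtain ⟨r, hr, hr'⟩ := step y hy 0 h0
        exact ⟨r, ⟨0, hr⟩, hr'⟩
      · obtain ⟨r, hr, hr'⟩ := step y hy 1 (by tauto)
        exact ⟨r, ⟨1, hr⟩, hr'⟩
    · rintro r ⟨i, hr⟩
      have hu : M.label .uni z := by
        have := h.exi_iff z
        tauto
      obtain ⟨y, hy, hi⟩ := h.uni_branch z (h.nr_last hz) (h.not_last_of_child hz hy) hu i
      obtain ⟨r', hr', hwin⟩ := step y hy i hi
      -- Spoiler's row and the tree's row for the set `i` coincide by well-formedness.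
      rwa [(hwf _ hp hc i).unique hr hr']

theorem proverWins (hwf : G.WellFormed) : G.ProverWins := by
  have := M.finite
  obtain ⟨D, hD⟩ := (Set.finite_range (depth : M.Node → ℕ)).bddAbove
  obtain ⟨w, hw, hw', hl⟩ := h.exists_complete_row (x := M.root)
    (by rw [h.nr_eq, depth_root, Nat.zero_mod])
  rw [depth_root, zero_add] at hw
  have hrow : rowsAt M τ 0 w = [G.initRow] := by rw [rowsAt, h.rowAt_eq_initRow hw]
  refine proverWins_of_winIn hwf (k := D + 1) (hrow ▸ h.winIn_rowsAt hwf (D := D + 1)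
    (fun x => ?_) (by omega) (by omega) ?_ (hw'.symm ▸ hl))
  · exact Nat.lt_succ_of_le (hD ⟨x, rfl⟩)
  · rw [hrow]
    exact .start

end IsModel

end TilingGame

/-! ### Plays following a winning strategy are bounded -/

theorem FiniteTree.depth_eq_of_child {F : FiniteTree} (d : F.Node → ℕ) (h0 : d F.root = 0)
    (hd : ∀ u v, F.child u v → d v = d u + 1) (x : F.Node) : depth x = d x := by
  induction F.reachable x with
  | refl => rw [depth_root, h0]
  | tail _ hc ih => rw [depth_of_child hc, hd _ _ hc, ih]

namespace TilingGame

open FiniteTree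

variable {G : TilingGame} {σ : List G.Row → G.Row}

theorem Follows.of_append {ρ : List G.Row} (hρ : ρ ≠ []) {l : List G.Row}
    (h : G.Follows σ (ρ ++ l)) : G.Follows σ ρ := by
  induction l using List.reverseRecOn with
  | nil => rwa [List.append_nil] at h
  | append_singleton l r ih =>
    rw [← List.append_assoc] at h
    exact ih (h.append_inv (by simp [hρ])).1

/-- By Kőnig's lemma, the plays that follow a winning strategy have bounded length. -/
theorem Wins.exists_length_le (hσ : G.Wins σ) : ∃ K, ∀ ρ, G.Follows σ ρ → ρ.length ≤ K := by
  let B (ρ : List G.Row) : Prop := ∃ K, ∀ l, G.Follows σ (ρ ++ l) → l.length ≤ K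
  have hB : ∀ ρ, ¬ B ρ → ∃ r, ¬ B (ρ ++ [r]) := by
    intro ρ h
    by_contra! hr
    choose K hK using hr
    -- Finite branching: there are only finitely many rows.
    obtain ⟨K', hK'⟩ := (Set.finite_range K).bddAbove
    refine h ⟨K' + 1, fun l hl => ?_⟩
    cases l with
    | nil => simp
    | cons r l =>
      have h1 : l.length ≤ K r := hK r l (by simpa using hl)
      have h2 : K r ≤ K' := hK' ⟨r, rfl⟩
      simp only [List.length_cons]
      omega
  by_contra hcon
  have h0 : ¬ B [G.initRow] := by
    rintro ⟨K, hK⟩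
    refine hcon ⟨K + 1, fun ρ hρ => ?_⟩
    obtain ⟨l, rfl⟩ : ∃ l, ρ = [G.initRow] ++ l := by
      have := hρ.play.head?_eq
      cases ρ with
      | nil => simp at this
      | cons r l =>
        simp only [List.head?_cons, Option.some.injEq] at this
        exact ⟨l, by simp [this]⟩
    have := hK l hρ
    simp only [List.length_append, List.length_singleton]
    omega
  choose next hnext using fun s : {ρ // ¬ B ρ} => hB s.1 s.2
  let seq : ℕ → {ρ // ¬ B ρ} := fun k =>
    Nat.rec ⟨[G.initRow], h0⟩ (fun _ s => ⟨s.1 ++ [next s], hnext s⟩) k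
  let π : ℕ → G.Row := fun k => Nat.casesOn k G.initRow fun k => next (seq k)
  have hπ : ∀ k, (List.range (k + 1)).map π = (seq k).1 := by
    intro k
    induction k with
    | zero => rfl
    | succ k ih =>
      rw [List.range_succ, List.map_append, ih]
      rfl
  refine hσ.2 ⟨π, fun k => ?_⟩
  by_contra hk
  -- Unbounded continuations include at least one, and its prefix follows `σ`.
  refine (seq k).2 ⟨0, fun l hl => ?_⟩
  rw [← hπ] at hl
  exact absurd (hl.of_append (by simp)) hk

/-! ### The tree of plays as a model -/

/-- The plays that follow `σ`, where each row comes with the number of the set chosen by the player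
who built it. -/
inductive Reached (σ : List G.Row → G.Row) : List (G.Row × Fin 2) → Prop
  | start : Reached σ [(G.initRow, 0)]
  | move {a : List (G.Row × Fin 2)} {r : G.Row} {i : Fin 2} : Reached σ a →
      ¬ G.Corridor (a.map Prod.fst) →
      (G.ProverTurn (a.map Prod.fst) → r = σ (a.map Prod.fst)) →
      G.CanBuild (a.map Prod.fst) i r → Reached σ (a ++ [(r, i)])

namespace Reached

variable {a : List (G.Row × Fin 2)}

theorem ne_nil (h : Reached σ a) : a ≠ [] := by
  cases h <;> simp

theorem length_pos (h : Reached σ a) : 0 < a.length :=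
  List.length_pos_of_ne_nil h.ne_nil

theorem follows (h : Reached σ a) : G.Follows σ (a.map Prod.fst) := by
  induction h with
  | start => exact .start
  | @move a r i _ hc ht hb ih =>
    rw [List.map_append, List.map_singleton]
    by_cases hturn : G.ProverTurn (a.map Prod.fst)
    · obtain rfl := ht hturn
      exact .prover ih hc hturn ⟨i, hb⟩
    · exact .spoiler ih hc hturn ⟨i, hb⟩

theorem append_inv {e : G.Row × Fin 2} (ha : a ≠ []) (h : Reached σ (a ++ [e])) :
    Reached σ a ∧ ¬ G.Corridor (a.map Prod.fst) ∧ G.CanBuild (a.map Prod.fst) e.2 e.1 := by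
  generalize hl : a ++ [e] = l at h
  cases h with
  | start =>
    have := congrArg List.length hl
    simp at this
    exact absurd this ha
  | move hr hc _ hb =>
    obtain ⟨rfl, h'⟩ := List.append_inj' hl rfl
    simp only [List.cons.injEq, and_true] at h'
    subst h'
    exact ⟨hr, hc, hb⟩

theorem exists_move (hσ : G.Wins σ) (h : Reached σ a) (hc : ¬ G.Corridor (a.map Prod.fst)) :
    ∃ e, Reached σ (a ++ [e]) := by
  obtain ⟨r, hr⟩ := hσ.1 _ h.follows hc
  obtain ⟨-, -, ⟨i, hb⟩, ht⟩ := hr.append_inv (by simpa using h.ne_nil)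
  exact ⟨(r, i), h.move hc ht hb⟩

end Reached

/-- A game need not have a correct initial row. Well-formedness supplies it: the initial row is a
corridor or can be extended to a partial tiling, whose first row is then correct. -/
theorem Play.partialTiling (hwf : G.WellFormed) {ρ : List G.Row} (h : G.Play ρ) :
    G.PartialTiling ρ := by
  cases h with
  | start =>
    by_cases hc : G.Corridor [G.initRow]
    · exact hc.1
    · obtain ⟨r, ⟨-, h1, h2, h3, h4⟩, -⟩ := hwf _ .start hc 0
      exact ⟨rfl, h2, fun r hr => h3 r (List.mem_append_left _ hr), List.isChain_singleton _⟩
  | move _ _ hm =>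
    obtain ⟨i, hm⟩ := hm
    exact hm.2

theorem finite_reached (hσ : G.Wins σ) : Finite {a // Reached σ a} := by
  obtain ⟨K, hK⟩ := hσ.exists_length_le
  refine ((List.finite_length_le (G.Row × Fin 2) K).subset fun a ha => ?_).to_subtype
  simpa using hK _ (Reached.follows ha)

/-- The tree of all plays that follow the winning strategy `σ`, each row being replaced by a path
with one node for each column. -/
def playTree (hσ : G.Wins σ) : FiniteTree where
  Node := {a // Reached σ a} × Fin (2 ^ G.n)
  finite := by
    have := finite_reached hσ
    infer_instance
  root := (⟨_, .start⟩, ⟨0, by positivity⟩)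
  child u v := (u.1 = v.1 ∧ (v.2 : ℕ) = u.2 + 1) ∨
    ((u.2 : ℕ) + 1 = 2 ^ G.n ∧ (v.2 : ℕ) = 0 ∧ ∃ e, v.1.1 = u.1.1 ++ [e])
  root_no_parent := by
    rintro ⟨⟨a, ha⟩, j⟩ (⟨-, h⟩ | ⟨-, -, e, h⟩)
    · simp at h
    · have h' := congrArg List.length h
      have := ha.length_pos
      simp only [List.length_append, List.length_singleton] at h'
      omega
  parent_unique := by
    rintro ⟨⟨a, ha⟩, j⟩ ⟨⟨a', ha'⟩, j'⟩ ⟨⟨b, hb⟩, k⟩ (⟨h1, h2⟩ | ⟨h1, h2, e, h3⟩)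
      (⟨h1', h2'⟩ | ⟨h1', h2', e', h3'⟩)
    · simp only at h1 h2 h1' h2'
      exact Prod.ext (h1.trans h1'.symm) (Fin.ext (by simp only; omega))
    · simp only at h2 h2'
      omega
    · simp only at h2 h2'
      omega
    · simp only at h1 h2 h1' h2' h3 h3'
      obtain ⟨rfl, -⟩ := List.append_inj' (h3.symm.trans h3') rfl
      exact Prod.ext rfl (Fin.ext (by simp only; omega))
  reachable := by
    rintro ⟨⟨a, ha⟩, j, hj⟩
    have hrow : ∀ (a : List (G.Row × Fin 2)) (ha : Reached σ a) (j : ℕ) (hj : j < 2 ^ G.n),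
        Relation.ReflTransGen (fun u v : {a // Reached σ a} × Fin (2 ^ G.n) =>
          (u.1 = v.1 ∧ (v.2 : ℕ) = u.2 + 1) ∨
          ((u.2 : ℕ) + 1 = 2 ^ G.n ∧ (v.2 : ℕ) = 0 ∧ ∃ e, v.1.1 = u.1.1 ++ [e]))
          (⟨a, ha⟩, ⟨0, by positivity⟩) (⟨a, ha⟩, ⟨j, hj⟩) := by
      intro a ha j
      induction j with
      | zero => exact fun _ => .refl
      | succ j ih => exact fun hj => (ih (by omega)).tail (.inl ⟨rfl, rfl⟩)
    refine .trans ?_ (hrow a ha j hj)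
    have hpos : 0 < 2 ^ G.n := by positivity
    induction ha with
    | start => exact .refl
    | @move a r i ha hc ht hb ih =>
      exact .tail (ih.trans (hrow a ha (2 ^ G.n - 1) (by omega)))
        (.inr ⟨Nat.sub_add_cancel hpos, rfl, _, rfl⟩)

/-- The last row of a play. -/
def lastRow (a : List (G.Row × Fin 2)) : G.Row := (a.getLastD (G.initRow, 0)).1

/-- The labelling of the tree of plays that satisfies the formula of the game. -/
def playModel (hσ : G.Wins σ) : LabelledTree G.Symbol where
  toFiniteTree := playTree hσ
  label p x := match p with
    | .bit i => (x.2 : ℕ).testBit i = true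
    | .tile t => lastRow x.1.1 x.2 = t
    | .color i c => lastRow x.1.1 x.2 i = c
    | .setT i => lastRow x.1.1 x.2 ∈ G.T i
    | .setL => lastRow x.1.1 x.2 ∈ G.L
    | .first => x.1.1.length = 1
    -- Below a corridor no play continues, and every other play is extended by the winning strategy
    -- or by Spoiler.
    | .last => G.Corridor (x.1.1.map Prod.fst)
    | .exi => Odd x.1.1.length
    | .uni => ¬ Odd x.1.1.length
    -- The initial row carries a dummy `0`. It gets no move label, because a move label would
    -- require the initial tiles to lie in that set.
    | .move i => 1 < x.1.1.length ∧ (x.1.1.getLastD (G.initRow, 0)).2 = i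

section PlayModel

variable (hσ : G.Wins σ)

/-- The node for the column `j` of the last row of the play `a`. -/
def playNode {a : List (G.Row × Fin 2)} (ha : Reached σ a) (j : ℕ) (hj : j < 2 ^ G.n) :
    (playModel hσ).Node :=
  (⟨a, ha⟩, ⟨j, hj⟩)

theorem forall_playNode {P : (playModel hσ).Node → Prop}
    (h : ∀ (a : List (G.Row × Fin 2)) (ha : Reached σ a) (j : ℕ) (hj : j < 2 ^ G.n),
      P (playNode hσ ha j hj)) (x : (playModel hσ).Node) : P x :=
  h x.1.1 x.1.2 x.2 x.2.2

variable {a : List (G.Row × Fin 2)} (ha : Reached σ a) {e : G.Row × Fin 2}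
  (hae : Reached σ (a ++ [e])) {j : ℕ} (hj : j < 2 ^ G.n)

theorem child_playNode_succ (hj : j + 1 < 2 ^ G.n) : (playModel hσ).child
    (playNode hσ ha j (Nat.lt_of_succ_lt hj)) (playNode hσ ha (j + 1) hj) :=
  .inl ⟨rfl, rfl⟩

theorem child_playNode_append : (playModel hσ).child
    (playNode hσ ha (2 ^ G.n - 1) (Nat.sub_lt (Nat.two_pow_pos _) one_pos))
    (playNode hσ hae 0 (Nat.two_pow_pos _)) :=
  .inr ⟨Nat.sub_add_cancel (Nat.two_pow_pos _), rfl, _, rfl⟩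

theorem nr_playNode : nr (playModel hσ) (playNode hσ ha j hj) = j := by
  rw [Nat.eq_iff_testBit_of_lt_two_pow (nr_lt _ _) hj]
  intro i
  rw [testBit_nr]
  rfl

theorem depth_playNode : depth (playNode hσ ha j hj) = (a.length - 1) * 2 ^ G.n + j := by
  refine depth_eq_of_child (F := playTree hσ)
    (fun x : {a // Reached σ a} × Fin (2 ^ G.n) => (x.1.1.length - 1) * 2 ^ G.n + x.2) ?_ ?_ _
  · simp [playTree]
  · rintro ⟨⟨a, ha⟩, j⟩ ⟨⟨b, hb⟩, k⟩ (⟨h1, h2⟩ | ⟨h1, h2, e, h3⟩)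
    · simp only at h1 h2
      rw [← h1, h2]
      rfl
    · simp only at h1 h2 h3
      subst h3
      have := ha.length_pos
      obtain ⟨m, hm⟩ := Nat.exists_eq_add_of_lt this
      simp only [List.length_append, List.length_singleton, hm, h2]
      simp only [zero_add, Nat.add_sub_cancel, Nat.succ_mul, add_zero]
      omega

theorem par_iterate_playNode {k : ℕ} (hk : k ≤ j) :
    (playModel hσ).par^[k] (playNode hσ ha j hj) = playNode hσ ha (j - k) (by omega) := by
  induction k with
  | zero => rfl
  | succ k ih =>
    rw [Function.iterate_succ_apply', ih (by omega)]
    have := child_playNode_succ hσ ha (j := j - (k + 1)) (by omega)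
    simp only [show j - (k + 1) + 1 = j - k by omega] at this
    exact par_eq this

theorem par_iterate_playNode_append :
    (playModel hσ).par^[2 ^ G.n] (playNode hσ hae j hj) = playNode hσ ha j hj := by
  have h1 := par_iterate_playNode hσ hae hj le_rfl
  have h2 := par_eq (child_playNode_append hσ ha hae)
  have h3 := par_iterate_playNode hσ ha (j := 2 ^ G.n - 1) (k := 2 ^ G.n - 1 - j) (by omega)
    (by omega)
  simp only [Nat.sub_self, show 2 ^ G.n - 1 - (2 ^ G.n - 1 - j) = j by omega] at h1 h3
  -- Going up: `j` steps to column `0`, one step to the last column of the shorter play, and `2 ^ n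
  -- - 1 - j` steps back to column `j`.
  rw [show 2 ^ G.n = (2 ^ G.n - 1 - j) + (1 + j) by omega, Function.iterate_add_apply,
    Function.iterate_add_apply, h1, Function.iterate_one, h2, h3]

end PlayModel

theorem lastRow_append (a : List (G.Row × Fin 2)) (e : G.Row × Fin 2) :
    lastRow (a ++ [e]) = e.1 := by
  simp [lastRow, List.getLastD_eq_getLast?]

namespace Reached

variable {a : List (G.Row × Fin 2)}

theorem eq_start_or_append (h : Reached σ a) : a = [(G.initRow, 0)] ∨
    ∃ b e, Reached σ b ∧ ¬ G.Corridor (b.map Prod.fst) ∧ G.CanBuild (b.map Prod.fst) e.2 e.1 ∧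
      a = b ++ [e] := by
  cases h with
  | start => exact .inl rfl
  | move hr hc _ hb => exact .inr ⟨_, _, hr, hc, hb, rfl⟩

theorem exists_append (h : Reached σ a) (ha : 1 < a.length) :
    ∃ b e, Reached σ b ∧ ¬ G.Corridor (b.map Prod.fst) ∧ G.CanBuild (b.map Prod.fst) e.2 e.1 ∧
      a = b ++ [e] := by
  rcases h.eq_start_or_append with rfl | h
  · simp at ha
  · exact h

theorem getLast?_map (h : Reached σ a) : (a.map Prod.fst).getLast? = some (lastRow a) := by
  rcases h.eq_start_or_append with rfl | ⟨b, e, -, -, -, rfl⟩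
  · rfl
  · rw [lastRow_append, List.map_append, List.map_singleton, List.getLast?_concat]

theorem rowCorrect (hwf : G.WellFormed) (h : Reached σ a) : G.RowCorrect (lastRow a) :=
  (h.follows.play.partialTiling hwf).2.2.1 _ (List.mem_of_getLast? h.getLast?_map)

theorem lastRow_mem_tiles (h : Reached σ a) (j : Fin (2 ^ G.n)) : lastRow a j ∈ G.tiles := by
  rcases h.eq_start_or_append with rfl | ⟨b, ⟨r, i⟩, -, -, hb, rfl⟩
  · simp only [lastRow, List.getLastD_cons, List.getLastD_nil, initRow]
    split_ifs <;> simp [tiles]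
  · rw [lastRow_append]
    have := hb.1 j
    fin_cases i <;> simp_all [tiles]

end Reached

theorem lastRow_vAdj (hwf : G.WellFormed) {a : List (G.Row × Fin 2)} {e : G.Row × Fin 2}
    (ha : Reached σ a) (hae : Reached σ (a ++ [e])) (j : Fin (2 ^ G.n)) :
    (lastRow a j).VAdj (lastRow (a ++ [e]) j) := by
  have h := (hae.follows.play.partialTiling hwf).2.2.2
  rw [List.map_append, List.map_singleton, List.isChain_append] at h
  rw [lastRow_append]
  exact h.2.2 _ ha.getLast?_map _ (by simp) j

theorem isModel_playModel (hwf : G.WellFormed) (hσ : G.Wins σ) :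
    IsModel (playModel hσ) fun x => lastRow x.1.1 x.2 := by
  have hpos : 0 < 2 ^ G.n := by positivity
  have hdepth : ∀ {a : List (G.Row × Fin 2)} (ha : Reached σ a) {j : ℕ} (hj : j < 2 ^ G.n),
      depth (playNode hσ ha j hj) < 2 ^ G.n ↔ a.length = 1 := by
    intro a ha j hj
    rw [depth_playNode]
    have := ha.length_pos
    constructor
    · intro h
      by_contra hne
      have := Nat.le_mul_of_pos_left (2 ^ G.n) (by omega : 0 < a.length - 1)
      omega
    · intro h
      simpa [h] using hj
  have hdepth' : ∀ {a : List (G.Row × Fin 2)} (ha : Reached σ a) {j : ℕ} (hj : j < 2 ^ G.n),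
      2 ^ G.n ≤ depth (playNode hσ ha j hj) ↔ 1 < a.length := by
    intro a ha j hj
    rw [← not_lt, hdepth]
    have := ha.length_pos
    omega
  have hinit : ∀ {a : List (G.Row × Fin 2)}, Reached σ a → a.length = 1 →
      lastRow a = G.initRow := by
    intro a ha h
    rcases ha.eq_start_or_append with rfl | ⟨b, e, hb, -, -, rfl⟩
    · rfl
    · have := hb.length_pos
      simp only [List.length_append, List.length_singleton] at h
      omega
  have hpar : ∀ {a : List (G.Row × Fin 2)} (ha : Reached σ a) {j : ℕ} (hj : j + 1 < 2 ^ G.n),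
      (playModel hσ).par (playNode hσ ha (j + 1) hj) = playNode hσ ha j (by omega) :=
    fun ha _ hj => par_eq (child_playNode_succ hσ ha hj)
  -- No reached play extends a corridor, so all descendants stay in the same row.
  have hdesc : ∀ {a : List (G.Row × Fin 2)} (ha : Reached σ a) {j : ℕ} (hj : j < 2 ^ G.n),
      G.Corridor (a.map Prod.fst) →
      ∀ y, Relation.TransGen (playModel hσ).child (playNode hσ ha j hj) y → y.1 = ⟨a, ha⟩ := by
    intro a ha j hj hc y hy
    have hchild : ∀ u v, (playModel hσ).child u v → u.1 = ⟨a, ha⟩ → v.1 = ⟨a, ha⟩ := by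
      rintro u ⟨⟨b, hb⟩, k⟩ (⟨h1, -⟩ | ⟨-, -, e, he⟩) hu
      · rw [← h1, hu]
      · simp only [hu] at he
        subst he
        exact absurd hc (hb.append_inv ha.ne_nil).2.1
    induction hy with
    | single h => exact hchild _ _ h rfl
    | tail _ h ih => exact hchild _ _ h ih
  exact {
    nr_eq := forall_playNode hσ fun a ha j hj => by
      rw [nr_playNode, depth_playNode, Nat.add_comm, Nat.add_mul_mod_self_right,
        Nat.mod_eq_of_lt hj]
    exists_child := forall_playNode hσ fun a ha j hj h => by
      rw [nr_playNode] at h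
      exact ⟨_, child_playNode_succ hσ ha (by omega)⟩
    color := fun _ _ _ => Iff.rfl
    tile_mem := fun x => x.1.2.lastRow_mem_tiles _
    tile := fun _ _ _ => Iff.rfl
    setT := fun _ _ => Iff.rfl
    setL := fun _ => Iff.rfl
    first := forall_playNode hσ fun a ha j hj => (hdepth ha hj).symm
    last := forall_playNode hσ fun a ha j hj => by
      constructor
      · rintro hc ⟨y, hy, hn⟩
        have h1 := hdesc ha hj hc y hy
        obtain ⟨k, h0, hk, hky⟩ := transGen_iff.1 hy
        have h2 := depth_par_iterate y hk
        rw [hky] at h2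
        obtain ⟨b, hb, l, hl, rfl⟩ : ∃ b hb l hl, y = playNode hσ (a := b) hb l hl :=
          ⟨_, _, _, _, rfl⟩
        rw [nr_playNode, nr_playNode] at hn
        rw [depth_playNode] at hk
        rw [depth_playNode, depth_playNode] at h2
        have h3 : b = a := congrArg Subtype.val h1
        subst h3
        omega
      · intro h
        by_contra hc
        obtain ⟨e, he⟩ := ha.exists_move hσ hc
        refine h ⟨playNode hσ he j hj, transGen_iff.2 ⟨2 ^ G.n, hpos, ?_,
          par_iterate_playNode_append hσ ha he hj⟩, by rw [nr_playNode, nr_playNode]⟩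
        rw [hdepth', List.length_append, List.length_singleton]
        have := ha.length_pos
        omega
    first_tile := forall_playNode hσ fun a ha j hj h => by
      rw [hdepth] at h
      change lastRow a ⟨j, hj⟩ = _
      rw [hinit ha h]
      congr
      exact (nr_playNode hσ ha hj).symm
    first_white := forall_playNode hσ fun a ha j hj h => by
      rw [hdepth] at h
      change lastRow a ⟨j, hj⟩ 0 = _ ∧ lastRow a ⟨j, hj⟩ 1 = _
      rw [hinit ha h]
      exact (Play.partialTiling hwf .start).2.1 _
    last_tile := forall_playNode hσ fun a ha j hj h => by
      obtain ⟨h1, h2, h3⟩ := h.2 _ ha.getLast?_map ⟨j, hj⟩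
      exact ⟨h2, h3, h1⟩
    exi_iff := fun _ => not_not.symm
    exi_par := forall_playNode hσ fun a ha j hj h => by
      rw [nr_playNode] at h
      obtain ⟨j, rfl⟩ := Nat.exists_eq_succ_of_ne_zero h
      rw [hpar ha hj]
      rfl
    exi_first := forall_playNode hσ fun a ha j hj h => by
      rw [hdepth] at h
      change Odd a.length
      rw [h]
      exact odd_one
    exi_par_row := forall_playNode hσ fun a ha j hj h h' => by
      rw [nr_playNode] at h
      rw [hdepth'] at h'
      subst h
      obtain ⟨b, e, hb, -, -, rfl⟩ := ha.exists_append h'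
      rw [par_eq (child_playNode_append hσ hb ha)]
      change Odd b.length ↔ ¬ Odd (b ++ [e]).length
      rw [List.length_append, List.length_singleton, Nat.odd_add_one, not_not]
    move_iff := forall_playNode hσ fun a ha j hj h => by
      rw [hdepth'] at h
      change 1 < a.length ∧ _ = (0 : Fin 2) ↔ ¬ (1 < a.length ∧ _ = (1 : Fin 2))
      simp only [h, true_and]
      omega
    move_par := forall_playNode hσ fun a ha j hj h => by
      rw [nr_playNode] at h
      obtain ⟨j, rfl⟩ := Nat.exists_eq_succ_of_ne_zero h
      rw [hpar ha hj]
      rfl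
    move_mem := fun i => forall_playNode hσ fun a ha j hj h => by
      obtain ⟨h1, h2⟩ := h
      change 1 < a.length at h1
      change (a.getLastD (G.initRow, 0)).2 = i at h2
      change lastRow a _ ∈ _
      obtain ⟨b, e, -, -, hb, rfl⟩ := ha.exists_append h1
      rw [lastRow_append]
      rw [List.getLastD_concat] at h2
      exact h2 ▸ hb.1 _
    uni_branch := forall_playNode hσ fun a ha j hj h hl hu i => by
      rw [nr_playNode] at h
      subst h
      -- At Spoiler's turn the strategy imposes nothing, so the row from either set continues a
      -- reached play.
      obtain ⟨r, hr, -⟩ := hwf _ ha.follows.play hl i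
      have hturn : ¬ G.ProverTurn (a.map Prod.fst) := by
        rw [ProverTurn, List.length_map]
        exact hu
      have hm := ha.move hl (fun h => absurd h hturn) hr
      refine ⟨_, child_playNode_append hσ ha hm, ?_⟩
      change 1 < (a ++ [(r, i)]).length ∧ ((a ++ [(r, i)]).getLastD (G.initRow, 0)).2 = i
      rw [List.getLastD_concat, List.length_append, List.length_singleton]
      have := ha.length_pos
      exact ⟨by omega, rfl⟩
    left_white := forall_playNode hσ fun a ha j hj h => by
      rw [nr_playNode] at h
      exact (ha.rowCorrect hwf).2.1 ⟨j, hj⟩ h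
    right_white := forall_playNode hσ fun a ha j hj h => by
      rw [nr_playNode] at h
      exact (ha.rowCorrect hwf).2.2 ⟨j, hj⟩ (by simp only; omega)
    hAdj := forall_playNode hσ fun a ha j hj h => by
      rw [nr_playNode] at h
      obtain ⟨j, rfl⟩ := Nat.exists_eq_succ_of_ne_zero h
      rw [hpar ha hj]
      exact (ha.rowCorrect hwf).1 ⟨j, by omega⟩ ⟨j + 1, hj⟩ rfl
    vAdj := forall_playNode hσ fun a ha j hj h => by
      rw [hdepth'] at h
      obtain ⟨b, e, hb, -, -, rfl⟩ := ha.exists_append h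
      rw [par_iterate_playNode_append hσ hb ha hj]
      exact lastRow_vAdj hwf hb ha ⟨j, hj⟩ }

end TilingGame

/-! ### The theorem -/

theorem mainTheorem4 :
    ∃ p : Polynomial ℕ, ∀ G : TilingGame, G.WellFormed →
      G.formula.IsSentence ∧
      G.formula.size ≤ p.eval G.size ∧
      (G.ProverWins ↔ G.formula.FinTreeSatisfiable) := by
  refine ⟨Polynomial.C 1100 * (Polynomial.X * Polynomial.X), fun G hwf =>
    ⟨G.isSentence_formula, by simpa using G.size_formula_le, ?_, ?_⟩⟩
  · rintro ⟨σ, hσ⟩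
    exact ⟨TilingGame.playModel hσ, fun s =>
      TilingGame.sat_formula.2 ⟨_, TilingGame.isModel_playModel hwf hσ⟩⟩
  · rintro ⟨M, hM⟩
    obtain ⟨τ, hτ⟩ := TilingGame.sat_formula.1 (hM fun _ => M.root)
    exact hτ.proverWins hwf
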